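/- Let $X$ be an $\mathbb R^d$-valued random vector whose distribution is absolutely continuous with respect to Lebesgue measure and whose moment generating function $M_X(t)=\mathbb E[e^{t^\top X}]$ is finite for every $t\in\mathbb R^d$, and let $X_1,X_2,\dots$ be i.i.d. copies of $X$. For $n\ge d+1$ let $\overline X_n=\frac1n\sum_{j=1}^n X_j$, $S_n=\frac1n\sum_{j=1}^n(X_j-\overline X_n)(X_j-\overline X_n)^\top$ and $Y_{n,j}=S_n^{-1/2}(X_j-\overline X_n)$, where $S_n^{-1/2}$ is the symmetric positive definite square root of $S_n^{-1}$ (which exists almost surely). For $\gamma>0$ put $w_\gamma(t)=e^{-\gamma\|t\|^2}$ and $$T_{n,\gamma}=\int_{\mathbb R^d} n\Big(\Big[\tfrac1n\sum_{j=1}^n\cos(t^\top Y_{n,j})\Big]\Big[\tfrac1n\sum_{j=1}^n e^{t^\top Y_{n,j}}\Big]-1\Big)^2 w_\gamma(t)\,dt .$$ Let $\Sigma$ be the covariance matrix of $X$ (it is positive definite), let $Z=\Sigma^{-1/2}(X-\mathbb EX)$ be the standardization of $X$ (so $Z=X$ if $\mathbb EX=0$ and $\Sigma=\mathrm I_d$),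 and put $R_Z(t)=\mathrm{Re}\,\mathbb E[e^{\mathrm i t^\top Z}]$, $M_Z(t)=\mathbb E[e^{t^\top Z}]$. (a) For every $\gamma>0$, almost surely $$\liminf_{n\to\infty}\frac{T_{n,\gamma}}n\ \ge\ \int_{\mathbb R^d}\big(R_Z(t)M_Z(t)-1\big)^2\,w_\gamma(t)\,dt\ \in[0,\infty].$$ (b) Consequently, the test that rejects normality for large values of $T_{n,\gamma}$ is consistent against every such alternative. Precisely, suppose that the distribution of $X$ is not a non-degenerate $d$-variate normal distribution. Then, for every $\gamma>0$ and every sequence $(c_n)$ of real critical values with $c_n/n\to0$ (in particular, every convergent sequence), $\mathbb P(T_{n,\gamma}>c_n)\to1$ as $n\to\infty$. Moreover, if $\gamma>1$ and $0<\alpha<1$, and $c_n(\alpha)$ is the level-$\alpha$ critical value, i.e. the smallest $c$ such that $T_{n,\gamma}>c$ has probability at most $\alpha$ whenever $X_1,\dots,X_n$ are i.i.d. with any non-degenerate $d$-variate normal distribution, then $\mathbb P(T_{n,\gamma}>c_n(\alpha))\to1$ as $n\to\infty$. -/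

import Mathlib

open MeasureTheory ProbabilityTheory Filter Topology
open scoped RealInnerProductSpace MatrixOrder ENNReal

noncomputable section

namespace NormalityTest

/-- The inverse symmetric square root `S^{-1/2}` of a positive definite matrix `S`, as a linear
map of `ℝ^d`. -/
def invSqrt {d : ℕ} (S : Matrix (Fin d) (Fin d) ℝ) :
    EuclideanSpace ℝ (Fin d) →L[ℝ] EuclideanSpace ℝ (Fin d) :=
  Matrix.toEuclideanCLM (𝕜 := ℝ) (CFC.sqrt S)⁻¹

/-- Sample mean of `x_1, …, x_n`. -/
def sampleMean {d n : ℕ} (x : Fin n → EuclideanSpace ℝ (Fin d)) : EuclideanSpace ℝ (Fin d) :=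
  (n : ℝ)⁻¹ • ∑ j, x j

/-- Sample covariance matrix `n⁻¹ ∑ (x_j - x̄)(x_j - x̄)ᵀ`. -/
def sampleCov {d n : ℕ} (x : Fin n → EuclideanSpace ℝ (Fin d)) : Matrix (Fin d) (Fin d) ℝ :=
  Matrix.of fun k l => (n : ℝ)⁻¹ * ∑ j, (x j - sampleMean x) k * (x j - sampleMean x) l

/-- Scaled residuals `S_n^{-1/2} (x_j - x̄)`. -/
def scaledResidual {d n : ℕ} (x : Fin n → EuclideanSpace ℝ (Fin d)) (j : Fin n) :
    EuclideanSpace ℝ (Fin d) :=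
  invSqrt (sampleCov x) (x j - sampleMean x)

/-- Empirical cosine transform of the scaled residuals. -/
def empCos {d n : ℕ} (x : Fin n → EuclideanSpace ℝ (Fin d)) (t : EuclideanSpace ℝ (Fin d)) : ℝ :=
  (n : ℝ)⁻¹ * ∑ j, Real.cos ⟪t, scaledResidual x j⟫

/-- Empirical moment generating function of the scaled residuals. -/
def empMGF {d n : ℕ} (x : Fin n → EuclideanSpace ℝ (Fin d)) (t : EuclideanSpace ℝ (Fin d)) : ℝ :=
  (n : ℝ)⁻¹ * ∑ j, Real.exp ⟪t, scaledResidual x j⟫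

/-- The process `U_n(t) = √n (R_n(t) M_n(t) - 1)`. -/
def empProcess {d n : ℕ} (x : Fin n → EuclideanSpace ℝ (Fin d)) (t : EuclideanSpace ℝ (Fin d)) :
    ℝ :=
  √(n : ℝ) * (empCos x t * empMGF x t - 1)

/-- The weight function `w_γ(t) = exp(-γ ‖t‖²)`. -/
def weight {d : ℕ} (γ : ℝ) (t : EuclideanSpace ℝ (Fin d)) : ℝ :=
  Real.exp (-γ * ‖t‖ ^ 2)

/-- The test statistic `T_{n,γ} = ∫ U_n(t)² w_γ(t) dt`. -/
def testStat {d n : ℕ} (γ : ℝ) (x : Fin n → EuclideanSpace ℝ (Fin d)) : ℝ :=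
  ∫ t, empProcess x t ^ 2 * weight γ t

/-- Real part of the characteristic function of the random vector `X`. -/
def realCharFun {d : ℕ} {Ω : Type*} [MeasurableSpace Ω] (P : Measure Ω)
    (X : Ω → EuclideanSpace ℝ (Fin d)) (t : EuclideanSpace ℝ (Fin d)) : ℝ :=
  (charFun (P.map X) t).re

/-- Moment generating function of the random vector `X`. -/
def momentGenFun {d : ℕ} {Ω : Type*} [MeasurableSpace Ω] (P : Measure Ω)
    (X : Ω → EuclideanSpace ℝ (Fin d)) (t : EuclideanSpace ℝ (Fin d)) : ℝ :=
  ∫ ω, Real.exp ⟪t, X ω⟫ ∂P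

/-- Covariance matrix of the random vector `X`. -/
def covMat {d : ℕ} {Ω : Type*} [MeasurableSpace Ω] (P : Measure Ω)
    (X : Ω → EuclideanSpace ℝ (Fin d)) : Matrix (Fin d) (Fin d) ℝ :=
  Matrix.of fun k l => cov[fun ω => X ω k, fun ω => X ω l; P]

/-- The standardization `Σ^{-1/2} (X - 𝔼 X)` of `X`, where `Σ` is its covariance matrix. -/
def standardized {d : ℕ} {Ω : Type*} [MeasurableSpace Ω] (P : Measure Ω)
    (X : Ω → EuclideanSpace ℝ (Fin d)) (ω : Ω) : EuclideanSpace ℝ (Fin d) :=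
  invSqrt (covMat P X) (X ω - ∫ ω', X ω' ∂P)

/-- The class of all non-degenerate `d`-variate normal distributions. -/
def nondegNormal (d : ℕ) : Set (Measure (EuclideanSpace ℝ (Fin d))) :=
  {Q | ∃ (m : EuclideanSpace ℝ (Fin d)) (S : Matrix (Fin d) (Fin d) ℝ),
    S.PosDef ∧ Q = multivariateGaussian m S}

/-- The critical value of the level-`α` test that rejects for large values of `T_{n,γ}`: the
smallest `c` such that `T_{n,γ} > c` has probability at most `α` when `X_1, …, X_n` are i.i.d.
with any non-degenerate normal distribution. -/
def criticalValue (d : ℕ) (γ α : ℝ) (n : ℕ) : ℝ :=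
  sInf {c : ℝ | ∀ Q ∈ nondegNormal d,
    Measure.pi (fun _ : Fin n => Q) {x | c < testStat γ x} ≤ ENNReal.ofReal α}

end NormalityTest

end

/-! For (a), a strong law that is uniform over convergent parameters shows that, almost surely and
for all `t` at once, the empirical cosine and exponential transforms of the scaled residuals
converge to `R_Z t` and `M_Z t` (`ae_tendsto_empCos_empMGF`). Fatou's lemma, applied to the
nonnegative integrands of `T_n / n`, then gives the bound (`lintegral_le_liminf_testStat`).

For (b), it must be shown that the limit integral is positive unless `X` is normal. If it vanishes,
continuity gives `R_Z M_Z = 1` everywhere, and in each direction this is a statement about one real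
variable `W`. Its complex moment generating function `M` is entire and satisfies `(M(iz) + M(-iz))
M(z) = 2`. Hence `M` has no zeros, is even, and `M(iz) M(z) = 1`. So `M = exp g` with `g` entire and
`g(iz) = -g(z)`. Since `|M(z)| ≤ M(Re z)` and `M(x) = E cosh(xW)` increases with `|x|`, `Re g` obeys
one-sided bounds which force `g(z) = c z^2` (`entire_eq_const_mul_sq`): the Poisson formula at four
symmetric points gives quadratic growth on the real line, Borel-Carathéodory extends it to the
plane, and Liouville finishes. Thus `W` is normal (`map_eq_gaussianReal_of_re_charFun_mul_mgf`), and
as the direction is arbitrary so is `X` (`map_mem_nondegNormal`).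

Consequently `T_n` eventually exceeds a positive multiple of `n`, which beats every `c_n = o(n)`.
The level-`α` critical values are `o(n)` when `γ > 1`: `T_n` is affine invariant
(`testStat_affine`), so a standard normal sample suffices, and there `T_n / n` tends to zero by
dominated convergence (`ae_tendsto_testStat_div_zero`). -/

namespace NormalityTest

/-! ### Entire functions with `g(iz) = -g(z)` and one-sided bounds -/

open Complex Metric in
theorem circleIntegrable_of_continuous {E : Type*} [NormedAddCommGroup E] {f : ℂ → E}
    (hf : Continuous f) (R : ℝ) : CircleIntegrable f 0 R :=
  hf.continuousOn.circleIntegrable'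

open Complex Metric in
/-- The real part of `z ^ 2 * k z` averaged against `cos 2θ` over a circle. -/
theorem circleAverage_re_mul_re_sq {k : ℂ → ℂ} (hk : Differentiable ℂ k) {r : ℝ} (hr : 0 < r) :
    Real.circleAverage (fun z => (z ^ 2 * k z).re * (z ^ 2).re) 0 r = r ^ 4 / 2 * (k 0).re := by
  have h1 : Real.circleAverage (fun z => z ^ 4 * k z) 0 r = 0 := by
    have := (DifferentiableOn.diffContOnCl (s := ball (0 : ℂ) |r|) (f := fun z : ℂ => z ^ 4 * k z)
      (by fun_prop)).circleAverage
    simpa using this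
  have h2 : Real.circleAverage k 0 r = k 0 :=
    (hk.differentiableOn.diffContOnCl (s := ball (0 : ℂ) |r|)).circleAverage
  have h3 : Real.circleAverage (fun z => (1 / 2 : ℂ) • (z ^ 4 * k z) + ((r : ℂ) ^ 4 / 2) • k z) 0 r
      = (r : ℂ) ^ 4 / 2 * k 0 := by
    rw [Real.circleAverage_fun_add, Real.circleAverage_fun_smul, Real.circleAverage_fun_smul,
      h1, h2]
    · simp
    · exact circleIntegrable_of_continuous (by have := hk.continuous; fun_prop) r
    · exact circleIntegrable_of_continuous (by have := hk.continuous; fun_prop) r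
  have h4 := Complex.reCLM.circleAverage_comp_comm (c := 0) (R := r)
    (f := fun z => (1 / 2 : ℂ) • (z ^ 4 * k z) + ((r : ℂ) ^ 4 / 2) • k z)
    (circleIntegrable_of_continuous (by have := hk.continuous; fun_prop) r)
  rw [h3] at h4
  have h5 : Complex.reCLM ((r : ℂ) ^ 4 / 2 * k 0) = r ^ 4 / 2 * (k 0).re := by
    have : ((r : ℂ) ^ 4 / 2) = ((r ^ 4 / 2 : ℝ) : ℂ) := by push_cast; ring
    rw [this]; simp [-ofReal_div, -ofReal_pow]
  rw [h5] at h4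
  rw [← h4]
  refine Real.circleAverage_congr_sphere fun z hz => ?_
  have hz' : z.re ^ 2 + z.im ^ 2 = r ^ 2 := by
    have : ‖z‖ = r := by simpa [abs_of_pos hr] using hz
    rw [← this, Complex.sq_norm, Complex.normSq_apply]; ring
  -- On the circle `r^4 = z^2 * conj z ^ 2`, so multiplying `z^2 k` by `Re (z^2)` gives a
  -- combination of the entire functions `z^4 k` and `k`, and the mean value property applies to
  -- both.
  have hconj : (r : ℂ) ^ 4 = z ^ 2 * (starRingEnd ℂ z) ^ 2 := by
    rw [← mul_pow, Complex.mul_conj, Complex.normSq_apply,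
      show z.re * z.re + z.im * z.im = r ^ 2 by rw [← hz']; ring]
    push_cast; ring
  have : (1 / 2 : ℂ) • (z ^ 4 * k z) + ((r : ℂ) ^ 4 / 2) • k z
      = (z ^ 2 * k z) * (((z ^ 2).re : ℝ) : ℂ) := by
    rw [hconj, Complex.re_eq_add_conj, map_pow]
    simp only [smul_eq_mul]; ring
  simp only [Function.comp, this, Complex.reCLM_apply, Complex.re_mul_ofReal]

-- The Poisson formula is used at `s`, `-s`, `is`, `-is` with signs `+, +, -, -`; the symmetry of
-- `g` turns the values into `4 g(s)`. With `q = cos 2θ` the signed kernel collapses to four times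
-- `12 q / (25 - 16 q^2)`, which has the sign of `q`. The radius `√2 s` makes `q` change sign
-- exactly where `|Re z| = |Im z| = s`.
open Complex Metric in
theorem poisson_four_points {g : ℂ → ℂ} (hg : Differentiable ℂ g)
    (hI : ∀ z, g (I * z) = -g z) {s : ℝ} (hs : 0 < s) :
    Real.circleAverage (fun z => (g z).re * (12 * ((z ^ 2).re / (2 * s ^ 2)) /
      (25 - 16 * ((z ^ 2).re / (2 * s ^ 2)) ^ 2))) 0 (√2 * s) = (g s).re := by
  have hsr : s < √2 * s := by
    have : 1 < √2 := Real.lt_sqrt_of_sq_lt (by norm_num)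
    nlinarith
  have hmem : ∀ w : ℂ, ‖w‖ = s → w ∈ ball (0 : ℂ) (√2 * s) := fun w hw => by simpa [hw] using hsr
  have P : ∀ w : ℂ, ‖w‖ = s →
      CircleIntegrable (poissonKernel 0 w • g) 0 (√2 * s) ∧
      Real.circleAverage (poissonKernel 0 w • g) 0 (√2 * s) = g w := fun w hw => by
    refine ⟨?_, hg.differentiableOn.diffContOnCl.circleAverage_poissonKernel_smul (hmem w hw)⟩
    refine (CircleIntegrable.continuousOn_smul (circleIntegrable_of_continuous hg.continuous _) ?_)
    rw [poissonKernel_eq_re_herglotzRieszKernel]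
    exact Complex.continuous_re.comp_continuousOn
      (continuousOn_herglotzRieszKernel_sphere (hmem w hw))
  have hneg : ∀ z, g (-z) = g z := fun z => by
    have := hI (I * z)
    rw [← mul_assoc, I_mul_I, hI, neg_neg, neg_one_mul] at this; exact this
  obtain ⟨i1, p1⟩ := P s (by simp [abs_of_pos hs])
  obtain ⟨i2, p2⟩ := P (-s) (by simp [abs_of_pos hs])
  obtain ⟨i3, p3⟩ := P (I * s) (by simp [abs_of_pos hs])
  obtain ⟨i4, p4⟩ := P (-(I * s)) (by simp [abs_of_pos hs])
  have key : Real.circleAverage ((poissonKernel 0 (s : ℂ) • g + poissonKernel 0 (-s : ℂ) • g)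
      - (poissonKernel 0 (I * s) • g + poissonKernel 0 (-(I * s)) • g)) 0 (√2 * s) = 4 * g s := by
    rw [Real.circleAverage_sub (i1.add i2) (i3.add i4), Real.circleAverage_add i1 i2,
      Real.circleAverage_add i3 i4, p1, p2, p3, p4, hneg, hneg, hI]
    ring
  have key2 := Complex.reCLM.circleAverage_comp_comm ((i1.add i2).sub (i3.add i4))
  rw [key] at key2
  have e1 : Complex.reCLM (4 * g s) = 4 * (g s).re := by simp
  rw [e1] at key2
  have key3 : (g s).re = (1 / 4 : ℝ) • (4 * (g s).re) := by simp
  rw [key3, ← key2, ← Real.circleAverage_smul]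
  refine Real.circleAverage_congr_sphere fun z hz => ?_
  have hr0 : 0 < √2 * s := by positivity
  have hz' : z.re ^ 2 + z.im ^ 2 = 2 * s ^ 2 := by
    have h1 : ‖z‖ = √2 * s := by
      have := mem_sphere_zero_iff_norm.1 hz
      rwa [abs_of_pos hr0] at this
    have h2 := Complex.sq_norm z
    rw [h1, Complex.normSq_apply, mul_pow, Real.sq_sqrt (by norm_num)] at h2
    nlinarith
  set x := z.re
  set y := z.im
  have n0 : ‖z‖ ^ 2 = 2 * s ^ 2 := by rw [Complex.sq_norm, Complex.normSq_apply, ← hz']; ring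
  have n1 : ‖z - s‖ ^ 2 = 3 * s ^ 2 - 2 * s * x := by
    rw [Complex.sq_norm, Complex.normSq_apply]; simp; linear_combination hz'
  have n2 : ‖z - -s‖ ^ 2 = 3 * s ^ 2 + 2 * s * x := by
    rw [Complex.sq_norm, Complex.normSq_apply]; simp; linear_combination hz'
  have n3 : ‖z - I * s‖ ^ 2 = 3 * s ^ 2 - 2 * s * y := by
    rw [Complex.sq_norm, Complex.normSq_apply]; simp; linear_combination hz'
  have n4 : ‖z - -(I * s)‖ ^ 2 = 3 * s ^ 2 + 2 * s * y := by
    rw [Complex.sq_norm, Complex.normSq_apply]; simp; linear_combination hz'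
  have ns : ‖(s : ℂ)‖ ^ 2 = s ^ 2 := by simp
  have nIs : ‖I * (s : ℂ)‖ ^ 2 = s ^ 2 := by simp
  have hq : (z ^ 2).re = x ^ 2 - y ^ 2 := by simp [sq, x, y]
  have hx : x ^ 2 ≤ 2 * s ^ 2 := by nlinarith [sq_nonneg y]
  have hy : y ^ 2 ≤ 2 * s ^ 2 := by nlinarith [sq_nonneg x]
  have d1 : 3 * s - 2 * x ≠ 0 := fun h => by nlinarith [mul_pos hs hs]
  have d2 : 3 * s + 2 * x ≠ 0 := fun h => by nlinarith [mul_pos hs hs]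
  have d3 : 3 * s - 2 * y ≠ 0 := fun h => by nlinarith [mul_pos hs hs]
  have d4 : 3 * s + 2 * y ≠ 0 := fun h => by nlinarith [mul_pos hs hs]
  have hker : (poissonKernel 0 (s : ℂ) z + poissonKernel 0 (-s : ℂ) z) -
      (poissonKernel 0 (I * s) z + poissonKernel 0 (-(I * s)) z)
      = 4 * (12 * ((z ^ 2).re / (2 * s ^ 2)) / (25 - 16 * ((z ^ 2).re / (2 * s ^ 2)) ^ 2)) := by
    simp only [poissonKernel_def, sub_zero, norm_neg, n0, n1, n2, n3, n4, ns, nIs, hq]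
    have hy2 : y ^ 2 = 2 * s ^ 2 - x ^ 2 := by linarith
    have e3 : (3 * s ^ 2 - 2 * s * x) * (3 * s ^ 2 + 2 * s * x) = s ^ 2 * (9 * s ^ 2 - 4 * x ^ 2) := by
      ring
    have e4 : (3 * s ^ 2 - 2 * s * y) * (3 * s ^ 2 + 2 * s * y) = s ^ 2 * (s ^ 2 + 4 * x ^ 2) := by
      linear_combination (-4 * s ^ 2) * hy2
    have f1 : 3 * s ^ 2 - 2 * s * x ≠ 0 := by
      rw [show 3 * s ^ 2 - 2 * s * x = s * (3 * s - 2 * x) by ring]; exact mul_ne_zero hs.ne' d1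
    have f2 : 3 * s ^ 2 + 2 * s * x ≠ 0 := by
      rw [show 3 * s ^ 2 + 2 * s * x = s * (3 * s + 2 * x) by ring]; exact mul_ne_zero hs.ne' d2
    have f3 : 3 * s ^ 2 - 2 * s * y ≠ 0 := by
      rw [show 3 * s ^ 2 - 2 * s * y = s * (3 * s - 2 * y) by ring]; exact mul_ne_zero hs.ne' d3
    have f4 : 3 * s ^ 2 + 2 * s * y ≠ 0 := by
      rw [show 3 * s ^ 2 + 2 * s * y = s * (3 * s + 2 * y) by ring]; exact mul_ne_zero hs.ne' d4
    have g1 : 9 * s ^ 2 - 4 * x ^ 2 ≠ 0 := by nlinarith [mul_pos hs hs]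
    have g2 : s ^ 2 + 4 * x ^ 2 ≠ 0 := by positivity
    have a1 : (2 * s ^ 2 - s ^ 2) / (3 * s ^ 2 - 2 * s * x) + (2 * s ^ 2 - s ^ 2) /
        (3 * s ^ 2 + 2 * s * x) = 6 * s ^ 2 / (9 * s ^ 2 - 4 * x ^ 2) := by
      rw [div_add_div _ _ f1 f2, e3, div_eq_div_iff (by positivity) g1]; ring
    have a2 : (2 * s ^ 2 - s ^ 2) / (3 * s ^ 2 - 2 * s * y) + (2 * s ^ 2 - s ^ 2) /
        (3 * s ^ 2 + 2 * s * y) = 6 * s ^ 2 / (s ^ 2 + 4 * x ^ 2) := by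
      rw [div_add_div _ _ f3 f4, e4, div_eq_div_iff (by positivity) g2]; ring
    rw [a1, a2, hy2]
    have g3 : 25 - 16 * ((x ^ 2 - (2 * s ^ 2 - x ^ 2)) / (2 * s ^ 2)) ^ 2
        = (9 * s ^ 2 - 4 * x ^ 2) * (s ^ 2 + 4 * x ^ 2) / s ^ 4 := by
      field_simp; ring
    rw [g3, div_sub_div _ _ g1 g2]
    have hs4 : s ^ 4 ≠ 0 := by positivity
    have hs2 : 2 * s ^ 2 ≠ 0 := by positivity
    rw [div_div_eq_mul_div, mul_div_assoc', mul_div_assoc', div_mul_eq_mul_div, mul_div_assoc',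
      div_div, div_eq_div_iff (mul_ne_zero g1 g2) (mul_ne_zero hs2 (mul_ne_zero g1 g2))]
    ring
  have : ((poissonKernel 0 (s : ℂ) • g + poissonKernel 0 (-s : ℂ) • g)
      - (poissonKernel 0 (I * s) • g + poissonKernel 0 (-(I * s)) • g)) z
      = ((poissonKernel 0 (s : ℂ) z + poissonKernel 0 (-s : ℂ) z) -
      (poissonKernel 0 (I * s) z + poissonKernel 0 (-(I * s)) z)) • g z := by
    simp only [Pi.sub_apply, Pi.add_apply, Pi.smul_apply', sub_smul, add_smul]
  simp only [Pi.smul_apply, Function.comp, this, hker, Complex.reCLM_apply, Complex.smul_re,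
    smul_eq_mul]
  ring

open Complex Metric in
/-- An entire function `g` with `g (i z) = - g z` whose real part obeys the ridge bound
`Re g z ≤ Re g (Re z)` and is increasing in `|x|` on the real line is a multiple of `z ^ 2`. -/
theorem entire_eq_const_mul_sq {g : ℂ → ℂ} (hg : Differentiable ℂ g)
    (hI : ∀ z, g (I * z) = -g z) (hridge : ∀ z : ℂ, (g z).re ≤ (g z.re).re)
    (hmono : ∀ x y : ℝ, |x| ≤ |y| → (g x).re ≤ (g y).re) :
    ∃ c : ℂ, ∀ z, g z = c * z ^ 2 := by
  have g0 : g 0 = 0 := by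
    have := hI 0
    rw [mul_zero] at this
    exact self_eq_neg.1 this
  have g'0 : deriv g 0 = 0 := by
    have h1 : HasDerivAt (fun z => g (I * z)) (deriv g 0 * I) 0 := by
      have hd : HasDerivAt g (deriv g 0) (I * 0) := by
        rw [mul_zero]; exact (hg 0).hasDerivAt
      have hm : HasDerivAt (fun z : ℂ => I * z) I 0 := by simpa using (hasDerivAt_id' (0:ℂ)).const_mul I
      exact hd.comp (0 : ℂ) hm
    have h2 : HasDerivAt (fun z => g (I * z)) (-deriv g 0) 0 := by
      simp only [hI]; exact (hg 0).hasDerivAt.fun_neg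
    have h3 := h1.unique h2
    have h4 : deriv g 0 * (I + 1) = 0 := by linear_combination h3
    refine (mul_eq_zero.1 h4).resolve_right fun h => ?_
    have := congrArg Complex.re h
    simp at this
  have hd (f : ℂ → ℂ) (hf : Differentiable ℂ f) : Differentiable ℂ (dslope f 0) := by
    have := (Complex.differentiableOn_dslope (s := Set.univ) (c := (0 : ℂ)) (f := f)
      Filter.univ_mem).2 hf.differentiableOn
    exact differentiableOn_univ.1 this
  -- Since `g` and `g'` vanish at the origin, `k` is the entire extension of `g z / z ^ 2`; it
  -- remains to show that `k` is bounded.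
  set k : ℂ → ℂ := dslope (dslope g 0) 0 with hk_def
  have hk : Differentiable ℂ k := hd _ (hd _ hg)
  have hgk : ∀ z, g z = z ^ 2 * k z := fun z => by
    have e1 := sub_smul_dslope (dslope g 0) 0 z
    have e2 := sub_smul_dslope g 0 z
    rw [dslope_same, g'0] at e1
    rw [g0] at e2
    simp only [sub_zero, smul_eq_mul] at e1 e2
    rw [← e2, ← e1]; ring
  have h0 : ∀ x : ℝ, 0 ≤ (g x).re := fun x => by
    have := hmono 0 x (by simp)
    simpa [g0] using this
  -- The ridge bound at `iz`, where `g` changes sign, becomes a lower bound at `z`.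
  have hlow : ∀ z : ℂ, -(g z.im).re ≤ (g z).re := fun z => by
    have h1 := hridge (I * z)
    have h2 : (I * z).re = -z.im := by simp
    rw [hI, h2] at h1
    have h3 := hmono (-z.im) z.im (by simp)
    simp only [neg_re] at h1
    linarith
  -- quadratic growth on the positive half-line
  have hquad : ∀ s : ℝ, 0 < s → (g s).re ≤ (100 / 11 * |(k 0).re|) * s ^ 2 := fun s hs => by
    have hA := poisson_four_points hg hI hs
    have hr : 0 < √2 * s := by positivity
    have hB := circleAverage_re_mul_re_sq hk hr
    simp only [← hgk] at hB
    have hr4 : (√2 * s) ^ 4 = 4 * s ^ 4 := by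
      rw [mul_pow, show √2 ^ 4 = (√2 ^ 2) ^ 2 by ring, Real.sq_sqrt (by norm_num)]; norm_num
    rw [hr4] at hB
    have cre : Continuous fun z => (g z).re := Complex.continuous_re.comp hg.continuous
    have cq : Continuous fun z : ℂ => (z ^ 2).re := by fun_prop
    -- Put `F = Re g(z)`, `G = Re g(s)` and `Q = 12 / (25 - 16 q^2)`, which lies in `[12/25, 4/3]`.
    -- Once `F q + G ≥ 0`, one has `F q Q = (F q + G) Q - G Q ≤ (4/3) F q + (4/3 - 12/25) G`, and
    -- the last coefficient is `64/75`. As `64/75 < 1`, `G` can be absorbed on the left, and `(4/3)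
    -- / (11/75) = 100/11`.
    have hB' : Real.circleAverage (fun z => (4 / 3 / (2 * s ^ 2)) • ((g z).re * (z ^ 2).re)
        + 64 / 75 * (g s).re) 0 (√2 * s)
        = (4 / 3 / (2 * s ^ 2)) * (4 * s ^ 4 / 2 * (k 0).re) + 64 / 75 * (g s).re := by
      rw [Real.circleAverage_fun_add, Real.circleAverage_fun_smul, hB, Real.circleAverage_const,
        smul_eq_mul]
      · exact circleIntegrable_of_continuous (by fun_prop) _
      · exact circleIntegrable_of_continuous (by fun_prop) _
    have hsq : ∀ z ∈ sphere (0 : ℂ) |√2 * s|, z.re ^ 2 + z.im ^ 2 = 2 * s ^ 2 := fun z hz => by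
      have h1 : ‖z‖ = √2 * s := by
        have := mem_sphere_zero_iff_norm.1 hz
        rwa [abs_of_pos hr] at this
      have h2 := Complex.sq_norm z
      rw [h1, Complex.normSq_apply, mul_pow, Real.sq_sqrt (by norm_num)] at h2
      nlinarith
    have hqle : ∀ z ∈ sphere (0 : ℂ) |√2 * s|, |(z ^ 2).re / (2 * s ^ 2)| ≤ 1 := fun z hz => by
      have := hsq z hz
      have h2 : (z ^ 2).re = z.re ^ 2 - z.im ^ 2 := by simp [sq]
      rw [h2, abs_div, abs_of_pos (a := 2 * s ^ 2) (by positivity), div_le_one (by positivity),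
        abs_le]
      constructor <;> nlinarith [sq_nonneg z.re, sq_nonneg z.im]
    have hle : (g s).re ≤ (4 / 3 / (2 * s ^ 2)) * (4 * s ^ 4 / 2 * (k 0).re)
        + 64 / 75 * (g s).re := by
      rw [← hB']
      conv_lhs => rw [← hA]
      refine Real.circleAverage_mono ?_ (circleIntegrable_of_continuous (by fun_prop) _) ?_
      · refine ContinuousOn.circleIntegrable' (ContinuousOn.mul cre.continuousOn
          (ContinuousOn.div (by fun_prop) (by fun_prop) fun z hz => ?_))
        have := (sq_le_one_iff_abs_le_one _).2 (hqle z hz)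
        intro h
        linarith
      · intro z hz
        have hq := hqle z hz
        have hz2 := hsq z hz
        set q := (z ^ 2).re / (2 * s ^ 2) with hq_def
        have hq2 := (sq_le_one_iff_abs_le_one _).2 hq
        obtain ⟨hq3, hq4⟩ := abs_le.1 hq
        have e1 : (4 / 3 / (2 * s ^ 2)) • ((g z).re * (z ^ 2).re) = 4 / 3 * ((g z).re * q) := by
          rw [hq_def, smul_eq_mul]; field_simp
        -- On this circle `q ≥ 0` means `|Im z| ≤ s` and `q ≤ 0` means `|Re z| ≤ s`, so the bound on
        -- `Re g(z)` needed for each sign of `q` compares with `Re g(s)`.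
        have hFq : -(g s).re ≤ (g z).re * q := by
          have hcmp (x : ℝ) (hx : x ^ 2 ≤ s ^ 2) : (g x).re ≤ (g s).re :=
            hmono x s (sq_le_sq.1 hx)
          have hqe : q * (2 * s ^ 2) = z.re ^ 2 - z.im ^ 2 := by
            rw [hq_def, div_mul_cancel₀ _ (by positivity)]; simp [sq]
          rcases le_total 0 q with hq0 | hq0
          · have h1 := hcmp z.im (by nlinarith [mul_nonneg hq0 (sq_nonneg s)])
            have h2 := hlow z
            nlinarith [h0 s]
          · have h1 := hcmp z.re (by nlinarith [mul_nonneg (neg_nonneg.2 hq0) (sq_nonneg s)])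
            have h2 := hridge z
            nlinarith [h0 s]
        have hQ1 : 12 / (25 - 16 * q ^ 2) ≤ 4 / 3 := by
          rw [div_le_div_iff₀ (by linarith) (by norm_num)]; linarith
        have hQ2 : 12 / 25 ≤ 12 / (25 - 16 * q ^ 2) := by
          rw [div_le_div_iff₀ (by norm_num) (by linarith)]; nlinarith [sq_nonneg q]
        rw [e1, mul_div_right_comm]
        nlinarith [h0 s]
    have : (4 / 3 / (2 * s ^ 2)) * (4 * s ^ 4 / 2 * (k 0).re) = 4 / 3 * (k 0).re * s ^ 2 := by
      field_simp; ring
    rw [this] at hle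
    have h5 := mul_le_mul_of_nonneg_right (le_abs_self (k 0).re) (sq_nonneg s)
    linarith
  -- The added `1` keeps `C` positive even when `Re (k 0) = 0`; Borel-Carathéodory asks for a
  -- positive bound.
  set C := 100 / 11 * |(k 0).re| + 1 with hC
  have hCpos : 0 < C := by positivity
  have hgrow : ∀ z, ‖g z‖ ≤ 8 * C * 2 * ‖z‖ ^ 2 := fun z => by
    rcases eq_or_ne z 0 with rfl | hz
    · simp [g0]
    have hzp : 0 < ‖z‖ := norm_pos_iff.2 hz
    have := borelCaratheodory_zero (f := g) (M := C * (2 * ‖z‖) ^ 2) (R := 2 * ‖z‖) (z := z)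
      (by positivity) hg.differentiableOn (fun w hw => ?_) (by positivity)
      (by rw [mem_ball_zero_iff]; linarith) g0
    · refine this.trans ?_
      rw [show 2 * ‖z‖ - ‖z‖ = ‖z‖ by ring, mul_div_assoc, div_self hzp.ne']
      nlinarith [mul_pos hCpos (pow_pos hzp 2)]
    · have hw' : ‖w‖ < 2 * ‖z‖ := by simpa using hw
      refine (hridge w).trans ?_
      refine (hmono w.re (2 * ‖z‖) ?_).trans ?_
      · rw [abs_of_pos (a := 2 * ‖z‖) (by positivity)]
        exact (Complex.abs_re_le_norm w).trans hw'.le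
      · refine (hquad _ (by positivity)).trans ?_
        gcongr
        linarith
  have hkb : ∀ z, ‖k z‖ ≤ 8 * C * 2 := by
    have hd : Dense ({0}ᶜ : Set ℂ) := dense_compl_singleton 0
    have hcl : IsClosed {z | ‖k z‖ ≤ 8 * C * 2} :=
      isClosed_le hk.continuous.norm continuous_const
    have hsub : ({0}ᶜ : Set ℂ) ⊆ {z | ‖k z‖ ≤ 8 * C * 2} := fun z hz => by
      have h1 := hgrow z
      have hzp : 0 < ‖z‖ := norm_pos_iff.2 hz
      rw [hgk, norm_mul, norm_pow, mul_comm] at h1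
      exact le_of_mul_le_mul_right h1 (by positivity)
    intro z
    exact (hcl.closure_subset_iff.2 hsub) (hd z)
  obtain ⟨c, hc⟩ := hk.exists_const_forall_eq_of_bounded
    (isBounded_iff_forall_norm_le.2 ⟨8 * C * 2, by rintro _ ⟨z, rfl⟩; exact hkb z⟩)
  exact ⟨c, fun z => by rw [hgk, hc]; ring⟩

/-! ### The one-dimensional characterization of the centred normal law -/

/-- A zero-free entire function equal to `1` at the origin has an entire logarithm. -/
theorem exists_entire_log {M : ℂ → ℂ} (hM : Differentiable ℂ M) (hne : ∀ z, M z ≠ 0)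
    (h1 : M 0 = 1) : ∃ g : ℂ → ℂ, Differentiable ℂ g ∧ g 0 = 0 ∧ ∀ z, M z = Complex.exp (g z) := by
  have hd : Differentiable ℂ (deriv M) := by
    have := (hM.differentiableOn (s := Set.univ)).deriv isOpen_univ
    exact differentiableOn_univ.1 this
  obtain ⟨g, hg0, hg⟩ := ((hd.div hM hne).isExactOn_univ).with_val_at 0 0
  have hg' : ∀ z, HasDerivAt g (deriv M z / M z) z := fun z => hg z (Set.mem_univ z)
  refine ⟨g, fun z => (hg' z).differentiableAt, hg0, fun z => ?_⟩
  have hder : ∀ z, HasDerivAt (fun z => M z * Complex.exp (-g z)) 0 z := fun z => by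
    have := (hM z).hasDerivAt.mul ((hg' z).neg.cexp)
    refine this.congr_deriv ?_
    have := hne z
    simp only [Pi.neg_apply]
    field_simp
    ring
  have hc := is_const_of_deriv_eq_zero (fun z => (hder z).differentiableAt)
    (fun z => (hder z).deriv) z 0
  simp only [h1, hg0, neg_zero, Complex.exp_zero, mul_one] at hc
  rw [Complex.exp_neg, ← div_eq_mul_inv, div_eq_one_iff_eq (Complex.exp_ne_zero _)] at hc
  exact hc

/-- The identity theorem, with the real points `1 / (n + 1)` accumulating at the origin. -/
theorem eq_of_eq_on_real {f g : ℂ → ℂ} (hf : Differentiable ℂ f) (hg : Differentiable ℂ g)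
    (h : ∀ t : ℝ, f t = g t) (z : ℂ) : f z = g z := by
  have hf' : AnalyticOnNhd ℂ f Set.univ := fun z _ => hf.analyticAt z
  have hg' : AnalyticOnNhd ℂ g Set.univ := fun z _ => hg.analyticAt z
  refine congrFun (AnalyticOnNhd.eq_of_frequently_eq (z₀ := 0) hf' hg' ?_) z
  have h1 : Tendsto (fun n : ℕ => (((1 : ℝ) / (n + 1) : ℝ) : ℂ)) atTop (𝓝[≠] 0) := by
    refine tendsto_nhdsWithin_iff.2 ⟨?_, .of_forall fun n => ?_⟩
    · have := (Complex.continuous_ofReal.tendsto 0).comp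
        (tendsto_one_div_add_atTop_nhds_zero_nat (𝕜 := ℝ))
      simpa [Function.comp_def] using this
    · simp only [Set.mem_compl_iff, Set.mem_singleton_iff, Complex.ofReal_eq_zero]
      positivity
  exact h1.frequently (Frequently.of_forall fun n => h _)

/-- A real random variable with finite moment generating function `M` and characteristic function
`φ` such that `Re φ(t) · M(t) = 1` for all real `t` is centred normal. -/
theorem map_eq_gaussianReal_of_re_charFun_mul_mgf {Ω : Type*} [MeasurableSpace Ω] {P : Measure Ω}
    [IsProbabilityMeasure P] {W : Ω → ℝ} (hW : AEMeasurable W P)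
    (hint : ∀ t : ℝ, Integrable (fun ω => Real.exp (t * W ω)) P)
    (h : ∀ t : ℝ, (charFun (P.map W) t).re * mgf W P t = 1) :
    ∃ v : NNReal, P.map W = gaussianReal 0 v := by
  have hset : integrableExpSet W P = Set.univ := Set.eq_univ_of_forall hint
  have hpos : ∀ t, 0 < mgf W P t := fun t => mgf_pos (hint t)
  set M : ℂ → ℂ := complexMGF W P with hMdef
  have hM : Differentiable ℂ M := fun z =>
    (hasDerivAt_complexMGF (by simp [hset])).differentiableAt
  have hM0 : M 0 = 1 := by simp [M, complexMGF]
  -- At real `t` the values `M(it)` and `M(-it)` are conjugate, so their sum is twice the real part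
  -- of the characteristic function; the hypothesis then continues analytically to the plane.
  have hfun : ∀ z, (M (Complex.I * z) + M (-(Complex.I * z))) * M z = 2 := by
    refine eq_of_eq_on_real (f := fun z => (M (Complex.I * z) + M (-(Complex.I * z))) * M z)
      (g := fun _ => 2) (by fun_prop) (by fun_prop) fun t => ?_
    have e1 : M (Complex.I * t) = charFun (P.map W) t := by
      rw [mul_comm]; exact complexMGF_mul_I hW t
    have e2 : M (-(Complex.I * t)) = (starRingEnd ℂ) (charFun (P.map W) t) := by
      rw [← charFun_neg, ← complexMGF_mul_I hW]; congr 1; push_cast; ring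
    have e3 : M t = mgf W P t := complexMGF_ofReal t
    rw [e1, e2, e3, Complex.add_conj, ← Complex.ofReal_mul, mul_assoc, h]
    norm_num
  have hne : ∀ z, M z ≠ 0 := fun z hz => by
    have := hfun z
    rw [hz, mul_zero] at this
    norm_num at this
  -- The first factor in `hfun` is unchanged under `z ↦ -z` and never zero, so it cancels.
  have heven : ∀ z, M (-z) = M z := fun z => by
    have h1 := hfun z
    have h2 := hfun (-z)
    rw [mul_neg, neg_neg, add_comm] at h2
    have h3 : M (Complex.I * z) + M (-(Complex.I * z)) ≠ 0 := fun h0 => by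
      rw [h0, zero_mul] at h1; norm_num at h1
    exact mul_left_cancel₀ h3 (h2.trans h1.symm)
  have hrec : ∀ z, M (Complex.I * z) * M z = 1 := fun z => by
    have := hfun z
    rw [heven] at this
    linear_combination this / 2
  obtain ⟨g, hg, hg0, hgM⟩ := exists_entire_log hM hne hM0
  have hnorm : ∀ z, ‖M z‖ = Real.exp (g z).re := fun z => by rw [hgM, Complex.norm_exp]
  have hreal : ∀ x : ℝ, mgf W P x = Real.exp (g x).re := fun x => by
    rw [← hnorm, hMdef, complexMGF_ofReal, Complex.norm_real, Real.norm_of_nonneg (hpos x).le]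
  have hmgf_even : ∀ x : ℝ, mgf W P (-x) = mgf W P x := fun x => by
    have := heven x
    rw [hMdef, ← Complex.ofReal_neg, complexMGF_ofReal, complexMGF_ofReal] at this
    exact_mod_cast this
  -- Evenness replaces `exp` by `cosh`, whose dependence on `|x|` is monotone for each outcome.
  have hmgf_cosh : ∀ x : ℝ, mgf W P x = ∫ ω, Real.cosh (x * W ω) ∂P := fun x => by
    have h1 : ∫ ω, Real.cosh (x * W ω) ∂P = (mgf W P x + mgf W P (-x)) / 2 := by
      simp only [Real.cosh_eq, mgf]
      rw [integral_div, integral_add (hint x) (by simpa using hint (-x))]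
      simp
    rw [h1, hmgf_even]; ring
  have hcosh_int : ∀ x : ℝ, Integrable (fun ω => Real.cosh (x * W ω)) P := fun x => by
    simp only [Real.cosh_eq]
    exact ((hint x).add (by simpa using hint (-x))).div_const 2
  obtain ⟨c, hc⟩ := entire_eq_const_mul_sq hg
    (fun z => by
      -- The recursion only says that `g(iz) + g(z)` is a logarithm of `1`; differentiating shows
      -- that it is constant, and it vanishes at the origin.
      have hk : ∀ z, Complex.exp (g (Complex.I * z) + g z) = 1 := fun z => by
        rw [Complex.exp_add, ← hgM, ← hgM, hrec]
      have hkd : Differentiable ℂ fun z => g (Complex.I * z) + g z := by fun_prop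
      have hder : ∀ z, deriv (fun z => g (Complex.I * z) + g z) z = 0 := fun z => by
        have h1 := (hkd z).hasDerivAt.cexp
        simp only [hk] at h1
        have := h1.unique (hasDerivAt_const z (1 : ℂ))
        simpa using this
      have h3 := is_const_of_deriv_eq_zero hkd hder z 0
      simp only [mul_zero, hg0, add_zero] at h3
      exact eq_neg_of_add_eq_zero_left h3)
    (fun z => by
      have h1 := norm_complexMGF_le_mgf (X := W) (μ := P) (z := z)
      rw [← hMdef, hnorm, hreal] at h1
      exact Real.exp_le_exp.1 h1)
    (fun x y hxy => by
      rw [← Real.exp_le_exp, ← hreal, ← hreal, hmgf_cosh, hmgf_cosh]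
      refine integral_mono (hcosh_int x) (hcosh_int y) fun ω => ?_
      simp only [Real.cosh_le_cosh, abs_mul]
      gcongr)
  -- This makes `2 * c.re` admissible as a variance, so that `Real.toNNReal` does not truncate it.
  have hc0 : 0 ≤ c.re := by
    have h1 : (1 : ℝ) ≤ mgf W P 1 := by
      rw [hmgf_cosh]
      have : ∫ _, (1 : ℝ) ∂P ≤ ∫ ω, Real.cosh (1 * W ω) ∂P :=
        integral_mono (integrable_const _) (hcosh_int 1) fun ω => Real.one_le_cosh _
      simpa using this
    rw [hreal, hc] at h1
    simpa using h1
  refine ⟨(2 * c.re).toNNReal, ?_⟩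
  have hmgf : mgf W P = mgf id (gaussianReal 0 (2 * c.re).toNNReal) := by
    rw [mgf_id_gaussianReal]
    ext x
    rw [hreal, hc, Real.coe_toNNReal _ (by positivity)]
    have : (c * (x : ℂ) ^ 2).re = c.re * x ^ 2 := by
      rw [← Complex.ofReal_pow, Complex.re_mul_ofReal]
    rw [this]
    congr 1; ring
  have hEq : complexMGF W P = complexMGF id (gaussianReal 0 (2 * c.re).toNNReal) := by
    ext z
    exact eqOn_complexMGF_of_mgf hmgf (by simp [hset])
  have := Measure.ext_of_complexMGF_eq hW aemeasurable_id hEq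
  simpa using this

/-! ### Square roots of positive semidefinite matrices -/

section
open scoped Matrix.Norms.L2Operator

theorem continuousOn_matrix_sqrt {d : ℕ} :
    ContinuousOn (CFC.sqrt : Matrix (Fin d) (Fin d) ℝ → _) {S | S.PosSemidef} := by
  have := CFC.continuousOn_sqrt (A := Matrix (Fin d) (Fin d) ℝ)
  simpa only [Matrix.nonneg_iff_posSemidef] using this

end

section MatrixSqrt

variable {d : ℕ} {S : Matrix (Fin d) (Fin d) ℝ}

theorem sqrt_mul_sqrt (hS : S.PosSemidef) : CFC.sqrt S * CFC.sqrt S = S :=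
  CFC.sqrt_mul_sqrt_self S hS.nonneg

theorem sqrt_transpose : (CFC.sqrt S).transpose = CFC.sqrt S := by
  have := (Matrix.nonneg_iff_posSemidef.1 (CFC.sqrt_nonneg S)).isHermitian
  rwa [Matrix.IsHermitian, Matrix.conjTranspose_eq_transpose_of_trivial] at this

theorem det_sqrt_sq (hS : S.PosSemidef) : (CFC.sqrt S).det ^ 2 = S.det := by
  rw [sq, ← Matrix.det_mul, sqrt_mul_sqrt hS]

theorem det_sqrt_ne_zero (hS : S.PosSemidef) (h : S.det ≠ 0) : (CFC.sqrt S).det ≠ 0 := fun h0 => by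
  rw [← det_sqrt_sq hS, h0] at h
  simp at h

/-- A singular matrix has inverse `0` by convention. Because of this, affine invariance holds for
every sample, with no exceptional null set. -/
theorem invSqrt_eq_zero (hS : S.PosSemidef) (h : S.det = 0) : invSqrt S = 0 := by
  have h0 : (CFC.sqrt S).det = 0 := by
    have := det_sqrt_sq hS
    rw [h] at this
    exact pow_eq_zero_iff two_ne_zero |>.1 this
  rw [invSqrt, Matrix.nonsing_inv_apply_not_isUnit _ (by simp [h0]), map_zero]

theorem inner_invSqrt_comm (v w : EuclideanSpace ℝ (Fin d)) :
    ⟪v, invSqrt S w⟫ = ⟪invSqrt S v, w⟫ := by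
  have h : ContinuousLinearMap.adjoint (invSqrt S) = invSqrt S := by
    rw [invSqrt, ← ContinuousLinearMap.star_eq_adjoint, ← map_star, Matrix.star_eq_conjTranspose,
      Matrix.conjTranspose_eq_transpose_of_trivial, Matrix.transpose_nonsing_inv, sqrt_transpose]
  rw [← ContinuousLinearMap.adjoint_inner_left, h]

/-- The inverse square root is continuous along positive semidefinite matrices at a positive
definite limit. -/
theorem tendsto_invSqrt {ι : Type*} {l : Filter ι} {A : ι → Matrix (Fin d) (Fin d) ℝ}
    (hA : ∀ i, (A i).PosSemidef) (hS : S.PosDef) (h : Tendsto A l (𝓝 S)) :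
    Tendsto (fun i => invSqrt (A i)) l (𝓝 (invSqrt S)) := by
  have h1 : Tendsto (fun i => CFC.sqrt (A i)) l (𝓝 (CFC.sqrt S)) :=
    (continuousOn_matrix_sqrt S hS.posSemidef).tendsto.comp
      (tendsto_nhdsWithin_iff.2 ⟨h, .of_forall hA⟩)
  have h2 : Tendsto (fun i => (CFC.sqrt (A i))⁻¹) l (𝓝 (CFC.sqrt S)⁻¹) := by
    simp only [Matrix.inv_def, Ring.inverse_eq_inv']
    refine Tendsto.smul (Tendsto.inv₀ ?_ (det_sqrt_ne_zero hS.posSemidef hS.det_pos.ne')) ?_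
    · exact ((continuous_id.matrix_det).tendsto _).comp h1
    · exact ((continuous_id.matrix_adjugate).tendsto _).comp h1
  have hc : Continuous (Matrix.toEuclideanCLM (𝕜 := ℝ) (n := Fin d)) :=
    LinearMap.continuous_of_finiteDimensional
      (Matrix.toEuclideanCLM (𝕜 := ℝ) (n := Fin d)).toAlgEquiv.toLinearMap
  exact (hc.tendsto _).comp h2

end MatrixSqrt

/-! ### Integrability and measurability of the statistic for a fixed sample size -/

section Sample

variable {d n : ℕ}

theorem sampleCov_eq_smul_sum (x : Fin n → EuclideanSpace ℝ (Fin d)) :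
    sampleCov x = (n : ℝ)⁻¹ •
      ∑ j, Matrix.vecMulVec (x j - sampleMean x).ofLp (x j - sampleMean x).ofLp := by
  ext k l
  simp [sampleCov, Matrix.sum_apply, Matrix.vecMulVec_apply]

theorem sampleCov_posSemidef (x : Fin n → EuclideanSpace ℝ (Fin d)) :
    (sampleCov x).PosSemidef := by
  rw [sampleCov_eq_smul_sum]
  refine Matrix.PosSemidef.smul (Matrix.posSemidef_sum _ fun j _ => ?_) (by positivity)
  simpa using Matrix.posSemidef_vecMulVec_self_star (x j - sampleMean x).ofLp

theorem abs_empCos_le_one (x : Fin n → EuclideanSpace ℝ (Fin d)) (t : EuclideanSpace ℝ (Fin d)) :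
    |empCos x t| ≤ 1 := by
  rcases Nat.eq_zero_or_pos n with rfl | hn
  · simp [empCos]
  rw [empCos, abs_mul, abs_of_nonneg (a := (n : ℝ)⁻¹) (by positivity),
    inv_mul_le_iff₀ (by positivity), mul_one]
  calc |∑ j, Real.cos ⟪t, scaledResidual x j⟫| ≤ ∑ j : Fin n, |Real.cos ⟪t, scaledResidual x j⟫| :=
        Finset.abs_sum_le_sum_abs _ _
    _ ≤ ∑ j : Fin n, 1 := Finset.sum_le_sum fun j _ => Real.abs_cos_le_one _
    _ = n := by simp

theorem empMGF_nonneg (x : Fin n → EuclideanSpace ℝ (Fin d)) (t : EuclideanSpace ℝ (Fin d)) :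
    0 ≤ empMGF x t := by
  unfold empMGF; positivity

theorem exists_empMGF_le (x : Fin n → EuclideanSpace ℝ (Fin d)) :
    ∃ b : ℝ, 0 ≤ b ∧ ∀ t, empMGF x t ≤ Real.exp (b * ‖t‖) := by
  refine ⟨∑ j, ‖scaledResidual x j‖, by positivity, fun t => ?_⟩
  rcases Nat.eq_zero_or_pos n with rfl | hn
  · simp [empMGF]
  rw [empMGF, inv_mul_le_iff₀ (by positivity)]
  calc ∑ j, Real.exp ⟪t, scaledResidual x j⟫
      ≤ ∑ j : Fin n, Real.exp ((∑ j, ‖scaledResidual x j‖) * ‖t‖) := by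
        refine Finset.sum_le_sum fun j _ => Real.exp_le_exp.2 ?_
        refine (real_inner_le_norm _ _).trans ?_
        rw [mul_comm]
        gcongr
        exact Finset.single_le_sum (f := fun j => ‖scaledResidual x j‖)
          (fun _ _ => norm_nonneg _) (Finset.mem_univ j)
    _ = n * Real.exp ((∑ j, ‖scaledResidual x j‖) * ‖t‖) := by simp

theorem continuous_empCos (x : Fin n → EuclideanSpace ℝ (Fin d)) : Continuous (empCos x) := by
  unfold empCos; fun_prop

theorem continuous_empMGF (x : Fin n → EuclideanSpace ℝ (Fin d)) : Continuous (empMGF x) := by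
  unfold empMGF; fun_prop

theorem continuous_weight (γ : ℝ) : Continuous (weight γ : EuclideanSpace ℝ (Fin d) → ℝ) := by
  unfold weight; fun_prop

theorem weight_pos (γ : ℝ) (t : EuclideanSpace ℝ (Fin d)) : 0 < weight γ t := Real.exp_pos _

/-- Completing the square spends half of the Gaussian decay on the linear term, at the price of the
constant `exp (b^2 / (2γ))`. -/
theorem integrable_exp_mul_norm_sub {γ : ℝ} (hγ : 0 < γ) (b : ℝ) :
    Integrable fun t : EuclideanSpace ℝ (Fin d) => Real.exp (b * ‖t‖ - γ * ‖t‖ ^ 2) := by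
  have h1 := GaussianFourier.integrable_cexp_neg_mul_sq_norm_add
    (V := EuclideanSpace ℝ (Fin d)) (b := ((γ / 2 : ℝ) : ℂ)) (by simpa using half_pos hγ) 0 0
  have h2 : Integrable fun t : EuclideanSpace ℝ (Fin d) => Real.exp (-(γ / 2) * ‖t‖ ^ 2) := by
    refine h1.norm.congr (.of_forall fun t => ?_)
    simp only [zero_mul, add_zero, Complex.norm_exp]
    norm_cast
  refine (h2.const_mul (Real.exp (b ^ 2 / (2 * γ)))).mono' (by fun_prop) (.of_forall fun t => ?_)
  rw [Real.norm_of_nonneg (Real.exp_pos _).le, ← Real.exp_add, Real.exp_le_exp]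
  have : 0 ≤ (γ * ‖t‖ - b) ^ 2 / (2 * γ) := by positivity
  have e : (γ * ‖t‖ - b) ^ 2 / (2 * γ) = γ / 2 * ‖t‖ ^ 2 - b * ‖t‖ + b ^ 2 / (2 * γ) := by
    field_simp; ring
  linarith

theorem sq_mul_sub_one_le {R M B : ℝ} (hR : |R| ≤ 1) (hM : 0 ≤ M) (hMB : M ≤ B) (hB : 1 ≤ B) :
    (R * M - 1) ^ 2 ≤ 4 * B ^ 2 := by
  have h1 : |R * M| ≤ B := by
    rw [abs_mul, abs_of_nonneg hM]
    nlinarith [abs_nonneg R]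
  obtain ⟨h2, h3⟩ := abs_le.1 h1
  nlinarith

/-- For a fixed sample the empirical transforms grow at most exponentially in `‖t‖`, so every `γ >
0` is enough. Hence the Bochner integral in `testStat` is a genuine one and may be exchanged with
the `lintegral` of Fatou's lemma. -/
theorem integrable_sq_mul_weight {γ : ℝ} (hγ : 0 < γ) (x : Fin n → EuclideanSpace ℝ (Fin d)) :
    Integrable fun t => (empCos x t * empMGF x t - 1) ^ 2 * weight γ t := by
  obtain ⟨b, hb0, hb⟩ := exists_empMGF_le x
  refine ((integrable_exp_mul_norm_sub (d := d) hγ (2 * b)).const_mul 4).mono' ?_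
    (.of_forall fun t => ?_)
  · exact Continuous.aestronglyMeasurable ((((continuous_empCos x).mul
      (continuous_empMGF x)).sub continuous_const).pow 2 |>.mul (continuous_weight γ))
  · rw [Real.norm_of_nonneg (mul_nonneg (sq_nonneg _) (weight_pos γ t).le)]
    have h1 := sq_mul_sub_one_le (abs_empCos_le_one x t) (empMGF_nonneg x t) (hb t)
      (Real.one_le_exp (by positivity))
    calc _ ≤ 4 * Real.exp (b * ‖t‖) ^ 2 * weight γ t :=
          mul_le_mul_of_nonneg_right h1 (weight_pos γ t).le
      _ = _ := by
          rw [weight, ← Real.exp_nat_mul, mul_assoc, ← Real.exp_add]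
          congr 2; push_cast; ring

theorem testStat_div (γ : ℝ) (hn : 0 < n) (x : Fin n → EuclideanSpace ℝ (Fin d)) :
    testStat γ x / n = ∫ t, (empCos x t * empMGF x t - 1) ^ 2 * weight γ t := by
  have hn' : (0 : ℝ) < n := by exact_mod_cast hn
  rw [testStat, div_eq_iff hn'.ne', ← integral_mul_const]
  congr 1 with t
  rw [empProcess, mul_pow, Real.sq_sqrt hn'.le]; ring

theorem testStat_nonneg (γ : ℝ) (x : Fin n → EuclideanSpace ℝ (Fin d)) : 0 ≤ testStat γ x :=
  integral_nonneg fun t => mul_nonneg (sq_nonneg _) (weight_pos γ t).le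

theorem continuous_sampleMean :
    Continuous (sampleMean : (Fin n → EuclideanSpace ℝ (Fin d)) → _) := by
  unfold sampleMean; fun_prop

theorem continuous_sampleCov :
    Continuous (sampleCov : (Fin n → EuclideanSpace ℝ (Fin d)) → _) := by
  have := continuous_sampleMean (d := d) (n := n)
  refine continuous_matrix fun k l => ?_
  simp only [sampleCov, Matrix.of_apply]
  fun_prop

/-- The inverse root need not be continuous at samples with singular covariance; writing it as
adjugate over determinant still gives measurability. -/
theorem measurable_scaledResidual (j : Fin n) :
    Measurable fun x : Fin n → EuclideanSpace ℝ (Fin d) => scaledResidual x j := by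
  have hs : Continuous fun x : Fin n → EuclideanSpace ℝ (Fin d) => CFC.sqrt (sampleCov x) :=
    continuousOn_matrix_sqrt.comp_continuous continuous_sampleCov sampleCov_posSemidef
  have hinv (k l : Fin d) : Measurable fun x : Fin n → EuclideanSpace ℝ (Fin d) =>
      (CFC.sqrt (sampleCov x))⁻¹ k l := by
    simp only [Matrix.inv_def, Ring.inverse_eq_inv', Matrix.smul_apply, smul_eq_mul]
    exact (hs.matrix_det.measurable.inv).mul (hs.matrix_adjugate.matrix_elem k l).measurable
  have hm := continuous_sampleMean (d := d) (n := n)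
  have : Measurable fun x : Fin n → EuclideanSpace ℝ (Fin d) =>
      WithLp.toLp 2 ((CFC.sqrt (sampleCov x))⁻¹.mulVec (x j - sampleMean x).ofLp) := by
    refine (MeasurableEquiv.toLp 2 (Fin d → ℝ)).measurable.comp (measurable_pi_lambda _ fun k => ?_)
    simp only [Matrix.mulVec, dotProduct]
    refine Finset.measurable_sum _ fun l _ => (hinv k l).mul ?_
    exact Continuous.measurable (by fun_prop)
  exact this

theorem measurable_testStat (γ : ℝ) :
    Measurable fun x : Fin n → EuclideanSpace ℝ (Fin d) => testStat γ x := by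
  refine (StronglyMeasurable.integral_prod_right (ν := volume)
    (f := fun (x : Fin n → EuclideanSpace ℝ (Fin d)) t => empProcess x t ^ 2 * weight γ t)
    (Measurable.stronglyMeasurable ?_)).measurable
  have h (j : Fin n) : Measurable fun p : (Fin n → EuclideanSpace ℝ (Fin d)) ×
      EuclideanSpace ℝ (Fin d) => ⟪p.2, scaledResidual p.1 j⟫ :=
    measurable_snd.inner ((measurable_scaledResidual j).comp measurable_fst)
  have hw : Measurable (weight γ : EuclideanSpace ℝ (Fin d) → ℝ) := (continuous_weight γ).measurable
  unfold Function.uncurry empProcess empCos empMGF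
  fun_prop

end Sample

/-! ### Affine invariance of the statistic -/

section Affine

variable {d n : ℕ}

theorem sampleMean_affine (hn : 0 < n) (m : EuclideanSpace ℝ (Fin d))
    (A : Matrix (Fin d) (Fin d) ℝ) (z : Fin n → EuclideanSpace ℝ (Fin d)) :
    sampleMean (fun j => m + Matrix.toEuclideanCLM (𝕜 := ℝ) A (z j))
      = m + Matrix.toEuclideanCLM (𝕜 := ℝ) A (sampleMean z) := by
  have : (n : ℝ) ≠ 0 := by positivity
  simp only [sampleMean, Finset.sum_add_distrib, map_smul, map_sum, smul_add, Finset.sum_const,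
    Finset.card_univ, Fintype.card_fin]
  rw [← Nat.cast_smul_eq_nsmul ℝ, smul_smul, inv_mul_cancel₀ this, one_smul]

theorem sampleCov_affine (hn : 0 < n) (m : EuclideanSpace ℝ (Fin d))
    (A : Matrix (Fin d) (Fin d) ℝ) (z : Fin n → EuclideanSpace ℝ (Fin d)) :
    sampleCov (fun j => m + Matrix.toEuclideanCLM (𝕜 := ℝ) A (z j))
      = A * sampleCov z * A.transpose := by
  simp only [sampleCov_eq_smul_sum, sampleMean_affine hn, add_sub_add_left_eq_sub, ← map_sub,
    Matrix.ofLp_toEuclideanCLM, Matrix.mul_smul, Matrix.smul_mul, Matrix.mul_sum, Matrix.sum_mul,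
    Matrix.mul_vecMulVec, Matrix.vecMulVec_mul, Matrix.vecMul_transpose]

/-- Under an invertible affine map of the sample the scaled residuals are rotated. -/
theorem exists_isometry_scaledResidual (hn : 0 < n) (m : EuclideanSpace ℝ (Fin d))
    {A : Matrix (Fin d) (Fin d) ℝ} (hA : A.det ≠ 0) (z : Fin n → EuclideanSpace ℝ (Fin d)) :
    ∃ U : EuclideanSpace ℝ (Fin d) ≃ₗᵢ[ℝ] EuclideanSpace ℝ (Fin d),
      ∀ j, scaledResidual (fun j => m + Matrix.toEuclideanCLM (𝕜 := ℝ) A (z j)) j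
        = U (scaledResidual z j) := by
  set x : Fin n → EuclideanSpace ℝ (Fin d) :=
    fun j => m + Matrix.toEuclideanCLM (𝕜 := ℝ) A (z j) with hx
  have hcov : sampleCov x = A * sampleCov z * A.transpose := sampleCov_affine hn m A z
  have hdiff : ∀ j, x j - sampleMean x
      = Matrix.toEuclideanCLM (𝕜 := ℝ) A (z j - sampleMean z) := fun j => by
    rw [hx, sampleMean_affine hn, map_sub, add_sub_add_left_eq_sub]
  have hdet : (sampleCov x).det = A.det ^ 2 * (sampleCov z).det := by
    rw [hcov, Matrix.det_mul, Matrix.det_mul, Matrix.det_transpose]; ring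
  -- For a degenerate sample all scaled residuals are `0`, so any isometry will do.
  by_cases h0 : (sampleCov z).det = 0
  · refine ⟨LinearIsometryEquiv.refl ℝ _, fun j => ?_⟩
    rw [scaledResidual, scaledResidual, invSqrt_eq_zero (sampleCov_posSemidef x) (by simp [hdet, h0]),
      invSqrt_eq_zero (sampleCov_posSemidef z) h0]
    simp
  have hx0 : (sampleCov x).det ≠ 0 := by rw [hdet]; positivity
  set P := CFC.sqrt (sampleCov x) with hP
  set Q := CFC.sqrt (sampleCov z) with hQ
  have hPd : IsUnit P.det := (det_sqrt_ne_zero (sampleCov_posSemidef x) hx0).isUnit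
  have hQd : IsUnit Q.det := (det_sqrt_ne_zero (sampleCov_posSemidef z) h0).isUnit
  have hPP : P * P = A * (Q * Q) * A.transpose := by
    rw [hP, hQ, sqrt_mul_sqrt (sampleCov_posSemidef x), sqrt_mul_sqrt (sampleCov_posSemidef z),
      hcov]
  -- `V` is orthogonal because `P^2 = A Q^2 Aᵀ`, and `V Q⁻¹ = P⁻¹ A` is what relates the two
  -- families of residuals.
  set V := P⁻¹ * A * Q with hV
  have hVV : V * star V = 1 := by
    rw [Matrix.star_eq_conjTranspose, Matrix.conjTranspose_eq_transpose_of_trivial, hV,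
      Matrix.transpose_mul, Matrix.transpose_mul, Matrix.transpose_nonsing_inv, hQ, hP,
      sqrt_transpose, sqrt_transpose, ← hQ, ← hP]
    calc P⁻¹ * A * Q * (Q * (A.transpose * P⁻¹)) = P⁻¹ * (A * (Q * Q) * A.transpose) * P⁻¹ := by
          noncomm_ring
      _ = (P⁻¹ * P) * (P * P⁻¹) := by rw [← hPP]; noncomm_ring
      _ = 1 := by rw [Matrix.nonsing_inv_mul _ hPd, Matrix.mul_nonsing_inv _ hPd, one_mul]
  have hVV' : star V * V = 1 := mul_eq_one_comm.1 hVV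
  let u : unitary (EuclideanSpace ℝ (Fin d) →L[ℝ] EuclideanSpace ℝ (Fin d)) :=
    ⟨Matrix.toEuclideanCLM (𝕜 := ℝ) V, by
      rw [Unitary.mem_iff, ← map_star, ← map_mul, ← map_mul, hVV, hVV', map_one]
      exact ⟨rfl, rfl⟩⟩
  refine ⟨Unitary.linearIsometryEquiv u, fun j => ?_⟩
  have hu : ∀ w, Unitary.linearIsometryEquiv u w = Matrix.toEuclideanCLM (𝕜 := ℝ) V w :=
    fun w => rfl
  rw [hu, scaledResidual, scaledResidual, hdiff, invSqrt, invSqrt, ← hP, ← hQ,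
    ← mul_apply_eq_comp, ← mul_apply_eq_comp, ← map_mul, ← map_mul, hV,
    Matrix.mul_assoc (P⁻¹ * A) Q, Matrix.mul_nonsing_inv _ hQd, Matrix.mul_one]

/-- The residuals are rotated; the rotation moves onto `t`, where both the weight and Lebesgue
measure are invariant. -/
theorem testStat_affine (γ : ℝ) (m : EuclideanSpace ℝ (Fin d))
    {A : Matrix (Fin d) (Fin d) ℝ} (hA : A.det ≠ 0) (z : Fin n → EuclideanSpace ℝ (Fin d)) :
    testStat γ (fun j => m + Matrix.toEuclideanCLM (𝕜 := ℝ) A (z j)) = testStat γ z := by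
  rcases Nat.eq_zero_or_pos n with rfl | hn
  · congr 1; exact Subsingleton.elim _ _
  obtain ⟨U, hU⟩ := exists_isometry_scaledResidual hn m hA z
  have hsymm : ∀ t w, ⟪t, U w⟫ = ⟪U.symm t, w⟫ := fun t w => by
    rw [← U.inner_map_map (U.symm t), U.apply_symm_apply]
  have key : ∀ t, empProcess (fun j => m + Matrix.toEuclideanCLM (𝕜 := ℝ) A (z j)) t ^ 2 * weight γ t
      = empProcess z (U.symm t) ^ 2 * weight γ (U.symm t) := fun t => by
    simp only [empProcess, empCos, empMGF, hU, hsymm, weight, U.symm.norm_map]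
  simp only [testStat, key]
  exact U.symm.measurePreserving.integral_comp U.symm.toHomeomorph.measurableEmbedding
    (fun t => empProcess z t ^ 2 * weight γ t)

end Affine

/-! ### Convergence of averages along convergent parameters -/

section Parametric

/-- Averages of a function that is Lipschitz in a parameter converge along convergent parameters,
once they converge on a dense set of parameters. -/
theorem tendsto_average_of_dense {E Θ : Type*} [NormedAddCommGroup Θ] {f : Θ → E → ℝ} {F : Θ → ℝ}
    {G : ℕ → E → ℝ} {g : ℕ → ℝ} {D : Set Θ} (hD : Dense D) {x : ℕ → E}
    (hlip : ∀ (K : ℕ) a b y, ‖a‖ ≤ K → ‖b‖ ≤ K → |f a y - f b y| ≤ ‖a - b‖ * G K y)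
    (hF : ∀ (K : ℕ) a b, ‖a‖ ≤ K → ‖b‖ ≤ K → |F a - F b| ≤ ‖a - b‖ * g K)
    (hG : ∀ K, Tendsto (fun n : ℕ => (n : ℝ)⁻¹ • ∑ j : Fin n, G K (x j)) atTop (𝓝 (g K)))
    (hfD : ∀ q ∈ D, Tendsto (fun n : ℕ => (n : ℝ)⁻¹ • ∑ j : Fin n, f q (x j)) atTop (𝓝 (F q)))
    {a : ℕ → Θ} {a₀ : Θ} (ha : Tendsto a atTop (𝓝 a₀)) :
    Tendsto (fun n : ℕ => (n : ℝ)⁻¹ • ∑ j : Fin n, f (a n) (x j)) atTop (𝓝 (F a₀)) := by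
  obtain ⟨K, hK⟩ := exists_nat_gt (‖a₀‖ + 1)
  rw [Metric.tendsto_atTop]
  intro ε hε
  set L := |g K| + 1 with hL
  have hLpos : 0 < L := by positivity
  -- With `δ L ≤ ε / 4`, moving from `a n` to `q`, averaging at `q`, and moving from `q` to `a₀`
  -- cost at most `ε / 4` each; `δ ≤ 1` keeps all parameters in the ball of radius `K`.
  set δ := min 1 (ε / (4 * L)) with hδ
  have hδpos : 0 < δ := by positivity
  obtain ⟨q, hqD, hq⟩ := Metric.dense_iff.1 hD a₀ (δ / 2) (by positivity)
  rw [Metric.mem_ball, dist_eq_norm] at hqD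
  have hδ1 : δ ≤ 1 := min_le_left _ _
  have hδ2 : δ * (4 * L) ≤ ε := by
    have := min_le_right 1 (ε / (4 * L))
    rwa [← hδ, le_div_iff₀ (by positivity)] at this
  have hqK : ‖q‖ ≤ K := by
    have := norm_sub_norm_le q a₀
    linarith
  have e1 : ∀ᶠ n in atTop, ‖a n - a₀‖ < δ / 2 := by
    have := (tendsto_iff_norm_sub_tendsto_zero.1 ha).eventually_lt_const
      (show (0 : ℝ) < δ / 2 by positivity)
    exact this
  have e2 : ∀ᶠ n : ℕ in atTop, (n : ℝ)⁻¹ • ∑ j : Fin n, G K (x j) < L :=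
    (hG K).eventually_lt_const (by have := le_abs_self (g K); linarith)
  have e3 : ∀ᶠ n : ℕ in atTop, |(n : ℝ)⁻¹ • ∑ j : Fin n, f q (x j) - F q| < ε / 4 := by
    have := (tendsto_iff_norm_sub_tendsto_zero.1 (hfD q hq)).eventually_lt_const
      (show (0 : ℝ) < ε / 4 by positivity)
    exact this
  obtain ⟨N, hN⟩ := eventually_atTop.1 (e1.and (e2.and e3))
  refine ⟨N, fun n hn => ?_⟩
  obtain ⟨h1, h2, h3⟩ := hN n hn
  have haK : ‖a n‖ ≤ K := by
    have := norm_sub_norm_le (a n) a₀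
    linarith
  have haq : ‖a n - q‖ ≤ δ := by
    have h4 : a n - q = (a n - a₀) - (q - a₀) := by abel
    rw [h4]
    exact (norm_sub_le _ _).trans (by linarith)
  have hA : |(n : ℝ)⁻¹ • ∑ j : Fin n, f (a n) (x j) - (n : ℝ)⁻¹ • ∑ j : Fin n, f q (x j)|
      ≤ δ * L := by
    rw [← smul_sub, ← Finset.sum_sub_distrib, smul_eq_mul, abs_mul,
      abs_of_nonneg (a := (n : ℝ)⁻¹) (by positivity)]
    calc (n : ℝ)⁻¹ * |∑ j : Fin n, (f (a n) (x j) - f q (x j))|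
        ≤ (n : ℝ)⁻¹ * ∑ j : Fin n, ‖a n - q‖ * G K (x j) := by
          gcongr
          exact (Finset.abs_sum_le_sum_abs _ _).trans
            (Finset.sum_le_sum fun j _ => hlip K _ _ _ haK hqK)
      _ = ‖a n - q‖ * ((n : ℝ)⁻¹ • ∑ j : Fin n, G K (x j)) := by
          rw [← Finset.mul_sum, smul_eq_mul]; ring
      _ ≤ ‖a n - q‖ * L := by gcongr
      _ ≤ δ * L := by gcongr
  have hB : |F q - F a₀| ≤ δ * L := by
    refine (hF K q a₀ hqK (by linarith)).trans ?_
    have h5 : g K ≤ L := by have := le_abs_self (g K); linarith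
    calc ‖q - a₀‖ * g K ≤ ‖q - a₀‖ * L := by gcongr
      _ ≤ δ * L := by gcongr; linarith
  rw [Real.dist_eq]
  obtain ⟨a1, a2⟩ := abs_le.1 hA
  obtain ⟨b1, b2⟩ := abs_le.1 hB
  obtain ⟨c1, c2⟩ := abs_lt.1 h3
  rw [abs_lt]
  constructor <;> linarith

end Parametric

/-! ### Exponential moments and positive definiteness of the covariance -/

section Moments

variable {d : ℕ} {Ω : Type*} [MeasurableSpace Ω] {P : Measure Ω} [IsProbabilityMeasure P]
  {X : Ω → EuclideanSpace ℝ (Fin d)}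

theorem integrable_exp_mul_norm (hX : AEMeasurable X P)
    (hmgf : ∀ t : EuclideanSpace ℝ (Fin d), Integrable (fun ω => Real.exp ⟪t, X ω⟫) P) (K : ℝ) :
    Integrable (fun ω => Real.exp (K * ‖X ω‖)) P := by
  have hi : ∀ (c : ℝ) (i : Fin d), Integrable (fun ω => Real.exp (c * X ω i)) P := fun c i => by
    have := hmgf (c • EuclideanSpace.single i 1)
    simpa [real_inner_smul_left, EuclideanSpace.inner_single_left] using this
  -- The norm is at most `d` times the largest `|X ω i|`, which is one of `± X ω i`. The summand `1`
  -- is what covers `d = 0`.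
  have hsum : Integrable (fun ω => 1 + ∑ i, (Real.exp (|K| * d * X ω i)
      + Real.exp (-(|K| * d) * X ω i))) P :=
    (integrable_const _).add (integrable_finsetSum _ fun i _ => (hi _ i).add (hi _ i))
  refine hsum.mono' (by fun_prop) (.of_forall fun ω => ?_)
  rw [Real.norm_of_nonneg (Real.exp_pos _).le]
  have hle : Real.exp (K * ‖X ω‖) ≤ Real.exp (|K| * ‖X ω‖) := by
    gcongr; exact le_abs_self K
  refine hle.trans ?_
  rcases Nat.eq_zero_or_pos d with rfl | hd
  · have : X ω = 0 := Subsingleton.elim _ _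
    simp [this]
  have : Nonempty (Fin d) := ⟨⟨0, hd⟩⟩
  obtain ⟨i, -, hmax⟩ := Finset.exists_max_image Finset.univ (fun i => |X ω i|) Finset.univ_nonempty
  have hn : ‖X ω‖ ≤ d * |X ω i| := by
    rw [EuclideanSpace.norm_eq, Real.sqrt_le_left (by positivity)]
    calc ∑ k, ‖X ω k‖ ^ 2 ≤ ∑ k : Fin d, |X ω i| ^ 2 := by
          refine Finset.sum_le_sum fun k _ => ?_
          rw [Real.norm_eq_abs]
          exact pow_le_pow_left₀ (abs_nonneg _) (hmax k (Finset.mem_univ k)) 2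
      _ = d * |X ω i| ^ 2 := by simp
      _ ≤ (d * |X ω i|) ^ 2 := by
          rw [mul_pow]
          gcongr
          have : (1 : ℝ) ≤ d := by exact_mod_cast hd
          nlinarith
  have hexp : Real.exp (|K| * ‖X ω‖) ≤ Real.exp (|K| * d * X ω i) + Real.exp (-(|K| * d) * X ω i) := by
    calc Real.exp (|K| * ‖X ω‖) ≤ Real.exp (|K| * (d * |X ω i|)) := by gcongr
      _ ≤ _ := by
        rcases abs_cases (X ω i) with ⟨h, -⟩ | ⟨h, -⟩ <;> rw [h]
        · rw [← mul_assoc]; exact le_add_of_nonneg_right (Real.exp_pos _).le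
        · rw [show |K| * (d * -X ω i) = -(|K| * d) * X ω i by ring]
          exact le_add_of_nonneg_left (Real.exp_pos _).le
  have hterm := Finset.single_le_sum (f := fun i => Real.exp (|K| * d * X ω i)
      + Real.exp (-(|K| * d) * X ω i)) (fun i _ => by positivity) (Finset.mem_univ i)
  dsimp only at hterm
  linarith

theorem memLp_two_of_mgf (hX : AEMeasurable X P)
    (hmgf : ∀ t : EuclideanSpace ℝ (Fin d), Integrable (fun ω => Real.exp ⟪t, X ω⟫) P) :
    MemLp X 2 P := by
  rw [memLp_two_iff_integrable_sq_norm hX.aestronglyMeasurable]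
  refine (integrable_exp_mul_norm hX hmgf 2).mono' (by fun_prop) (.of_forall fun ω => ?_)
  rw [Real.norm_of_nonneg (sq_nonneg _)]
  have h1 := Real.add_one_le_exp ‖X ω‖
  have h2 : Real.exp (2 * ‖X ω‖) = Real.exp ‖X ω‖ ^ 2 := by
    rw [← Real.exp_nat_mul]; norm_num
  rw [h2]
  gcongr
  linarith

omit [IsProbabilityMeasure P] in
theorem memLp_coord (hX2 : MemLp X 2 P) (k : Fin d) : MemLp (fun ω => X ω k) 2 P :=
  (EuclideanSpace.proj k : EuclideanSpace ℝ (Fin d) →L[ℝ] ℝ).comp_memLp' hX2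

theorem integral_coord (hX2 : MemLp X 2 P) (k : Fin d) : (∫ ω, X ω ∂P) k = ∫ ω, X ω k ∂P :=
  ((EuclideanSpace.proj k : EuclideanSpace ℝ (Fin d) →L[ℝ] ℝ).integral_comp_comm
    (hX2.integrable one_le_two)).symm

theorem dotProduct_covMat_mulVec (hX2 : MemLp X 2 P) (v : Fin d → ℝ) :
    v ⬝ᵥ (covMat P X).mulVec v = Var[fun ω => ⟪WithLp.toLp 2 v, X ω⟫; P] := by
  have hm := memLp_coord hX2
  have h1 : (fun ω => ⟪(WithLp.toLp 2 v : EuclideanSpace ℝ (Fin d)), X ω⟫)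
      = fun ω => ∑ k, v k * X ω k := by
    ext ω; simp [PiLp.inner_apply, mul_comm]
  have hmv : ∀ k, MemLp (fun ω => v k * X ω k) 2 P := fun k => (hm k).const_mul (v k)
  have h2 : AEMeasurable (fun ω => ∑ k, v k * X ω k) P :=
    (memLp_finsetSum _ fun k _ => hmv k).aestronglyMeasurable.aemeasurable
  rw [h1, ← covariance_self h2, covariance_fun_sum_fun_sum hmv hmv]
  simp only [covariance_const_mul_left, covariance_const_mul_right, dotProduct, Matrix.mulVec,
    covMat, Matrix.of_apply, Finset.mul_sum]
  refine Finset.sum_congr rfl fun k _ => Finset.sum_congr rfl fun l _ => by ring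

theorem volume_hyperplane {v : EuclideanSpace ℝ (Fin d)} (hv : v ≠ 0) (c : ℝ) :
    volume {x : EuclideanSpace ℝ (Fin d) | ⟪v, x⟫ = c} = 0 := by
  by_cases h : ∃ x₀, ⟪v, x₀⟫ = c
  · obtain ⟨x₀, hx₀⟩ := h
    rw [← measure_preimage_add_right volume x₀]
    have hne : LinearMap.ker (innerSL ℝ v).toLinearMap ≠ ⊤ := fun htop => by
      have : v ∈ LinearMap.ker (innerSL ℝ v).toLinearMap := htop ▸ Submodule.mem_top
      simp at this
      exact hv this
    convert Measure.addHaar_submodule (volume : Measure (EuclideanSpace ℝ (Fin d))) _ hne using 2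
    ext x
    simp [inner_add_right, hx₀]
  · have : {x : EuclideanSpace ℝ (Fin d) | ⟪v, x⟫ = c} = ∅ :=
      Set.eq_empty_of_forall_notMem fun x hx => h ⟨x, hx⟩
    rw [this, measure_empty]

/-- Zero variance in a direction would confine `X` almost surely to a hyperplane, which is Lebesgue
null. -/
theorem covMat_posDef (hX : AEMeasurable X P) (hX2 : MemLp X 2 P) (hac : P.map X ≪ volume) :
    (covMat P X).PosDef := by
  refine Matrix.PosDef.of_dotProduct_mulVec_pos ?_ fun v hv => ?_
  · ext k l
    simp [covMat, covariance_comm]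
  rw [star_trivial, dotProduct_covMat_mulVec hX2]
  refine lt_of_le_of_ne (variance_nonneg _ _) fun h0 => ?_
  have hL : MemLp (fun ω => ⟪(WithLp.toLp 2 v : EuclideanSpace ℝ (Fin d)), X ω⟫) 2 P :=
    hX2.const_inner _
  have hae := ae_eq_integral_of_variance_eq_zero hL h0.symm
  set c := P[fun ω => ⟪(WithLp.toLp 2 v : EuclideanSpace ℝ (Fin d)), X ω⟫]
  have hv' : (WithLp.toLp 2 v : EuclideanSpace ℝ (Fin d)) ≠ 0 := fun h => hv (by
    have := congrArg WithLp.ofLp h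
    simpa using this)
  have hnull := hac (volume_hyperplane hv' c)
  rw [Measure.map_apply_of_aemeasurable hX (measurableSet_eq_fun (by fun_prop) (by fun_prop))]
    at hnull
  obtain ⟨ω, h1, h2⟩ := (hae.and (measure_eq_zero_iff_ae_notMem.1 hnull)).exists
  exact h2 h1

end Moments

/-! ### Uniform strong law and almost sure limits of the empirical transforms -/

section StrongLaw

variable {d : ℕ} {Ω : Type*} [MeasurableSpace Ω] {P : Measure Ω} [IsProbabilityMeasure P]
  {X : Ω → EuclideanSpace ℝ (Fin d)} {Xs : ℕ → Ω → EuclideanSpace ℝ (Fin d)}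

omit [IsProbabilityMeasure P] in
theorem ae_tendsto_average {F : Type*} [NormedAddCommGroup F] [NormedSpace ℝ F] [CompleteSpace F]
    [MeasurableSpace F] [BorelSpace F]
    {E : Type*} [MeasurableSpace E] {X : Ω → E} {Xs : ℕ → Ω → E}
    (hindep : iIndepFun Xs P) (hident : ∀ j, IdentDistrib (Xs j) X P P)
    {φ : E → F} (hφ : Measurable φ)
    (hint : Integrable (fun ω => φ (X ω)) P) :
    ∀ᵐ ω ∂P, Tendsto (fun n : ℕ => (n : ℝ)⁻¹ • ∑ j : Fin n, φ (Xs j ω)) atTop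
      (𝓝 (∫ ω, φ (X ω) ∂P)) := by
  have hid : ∀ j, IdentDistrib (fun ω => φ (Xs j ω)) (fun ω => φ (X ω)) P P :=
    fun j => (hident j).comp hφ
  have := strong_law_ae (μ := P) (fun j ω => φ (Xs j ω)) ((hid 0).integrable_iff.2 hint)
    (fun i j hij => (hindep.indepFun hij).comp hφ hφ) (fun j => (hid j).trans (hid 0).symm)
  rw [(hid 0).integral_eq] at this
  filter_upwards [this] with ω hω
  simpa only [Finset.sum_range] using hω

theorem abs_exp_sub_exp_le {u v B : ℝ} (hu : |u| ≤ B) (hv : |v| ≤ B) :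
    |Real.exp u - Real.exp v| ≤ |u - v| * Real.exp B := by
  wlog h : v ≤ u generalizing u v
  · rw [abs_sub_comm, abs_sub_comm u]; exact this hv hu (le_of_not_ge h)
  have h1 := Real.add_one_le_exp (v - u)
  have h2 : Real.exp v = Real.exp u * Real.exp (v - u) := by rw [← Real.exp_add]; congr 1; ring
  have h3 : Real.exp u ≤ Real.exp B := Real.exp_le_exp.2 ((le_abs_self u).trans hu)
  have h4 : Real.exp v ≤ Real.exp u := Real.exp_le_exp.2 h
  rw [abs_of_nonneg (by linarith), abs_of_nonneg (by linarith)]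
  calc Real.exp u - Real.exp v ≤ (u - v) * Real.exp u := by nlinarith [Real.exp_pos u]
    _ ≤ (u - v) * Real.exp B := by gcongr

omit [IsProbabilityMeasure P] in
/-- Uniform strong law for `φ (⟪a, X⟫ - b)` along convergent parameters. -/
theorem ae_forall_tendsto_average {E : Type*} [NormedAddCommGroup E] [InnerProductSpace ℝ E]
    [SecondCountableTopology E] [MeasurableSpace E] [BorelSpace E] {X : Ω → E} {Xs : ℕ → Ω → E}
    (hindep : iIndepFun Xs P) (hident : ∀ j, IdentDistrib (Xs j) X P P)
    (hexp : ∀ K : ℝ, Integrable (fun ω => Real.exp (K * ‖X ω‖)) P)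
    {φ : ℝ → ℝ} (hφ : Continuous φ)
    (hlip : ∀ B u v, |u| ≤ B → |v| ≤ B → |φ u - φ v| ≤ |u - v| * Real.exp B)
    (hbd : ∀ u, |φ u| ≤ Real.exp |u|) :
    ∀ᵐ ω ∂P, ∀ (a : ℕ → E) (b : ℕ → ℝ) a₀ b₀,
      Tendsto a atTop (𝓝 a₀) → Tendsto b atTop (𝓝 b₀) →
      Tendsto (fun n : ℕ => (n : ℝ)⁻¹ • ∑ j : Fin n, φ (⟪a n, Xs j ω⟫ - b n)) atTop
        (𝓝 (∫ ω, φ (⟪a₀, X ω⟫ - b₀) ∂P)) := by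
  have hX : AEMeasurable X P := (hident 0).aemeasurable_snd
  let f : E × ℝ → E → ℝ := fun p x => φ (⟪p.1, x⟫ - p.2)
  let G : ℕ → E → ℝ := fun K x => (‖x‖ + 1) * Real.exp (K * ‖x‖ + K)
  have harg : ∀ (K : ℝ) (p : E × ℝ) (x : E), ‖p‖ ≤ K → |⟪p.1, x⟫ - p.2| ≤ K * ‖x‖ + K :=
    fun K p x hp => by
      have h1 : ‖p.1‖ ≤ K := (norm_fst_le p).trans hp
      have h2 : |p.2| ≤ K := (norm_snd_le p).trans hp
      calc |⟪p.1, x⟫ - p.2| ≤ |⟪p.1, x⟫| + |p.2| := abs_sub _ _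
        _ ≤ ‖p.1‖ * ‖x‖ + |p.2| := by gcongr; exact abs_real_inner_le_norm _ _
        _ ≤ K * ‖x‖ + K := by gcongr
  have hl : ∀ (K : ℕ) p q x, ‖p‖ ≤ K → ‖q‖ ≤ K → |f p x - f q x| ≤ ‖p - q‖ * G K x := by
    intro K p q x hp hq
    refine (hlip _ _ _ (harg K p x hp) (harg K q x hq)).trans ?_
    have h1 : |⟪p.1, x⟫ - p.2 - (⟪q.1, x⟫ - q.2)| ≤ ‖p - q‖ * ‖x‖ + ‖p - q‖ := by
      have := harg ‖p - q‖ (p - q) x le_rfl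
      rw [Prod.fst_sub, Prod.snd_sub, inner_sub_left] at this
      convert this using 2
      ring
    calc _ ≤ (‖p - q‖ * ‖x‖ + ‖p - q‖) * Real.exp (K * ‖x‖ + K) := by gcongr
      _ = ‖p - q‖ * G K x := by simp only [G]; ring
  have hfm : ∀ p, Measurable (f p) := fun p => Continuous.measurable (by fun_prop)
  have hGm : ∀ K, Measurable (G K) := fun K => Continuous.measurable (by fun_prop)
  have hGint : ∀ K, Integrable (fun ω => G K (X ω)) P := fun K => by
    refine ((hexp (K + 1)).mul_const (Real.exp K)).mono'
      ((hGm K).comp_aemeasurable hX).aestronglyMeasurable (.of_forall fun ω => ?_)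
    rw [Real.norm_of_nonneg (by positivity)]
    have := Real.add_one_le_exp ‖X ω‖
    calc G K (X ω) ≤ Real.exp ‖X ω‖ * Real.exp (K * ‖X ω‖ + K) := by simp only [G]; gcongr
      _ = _ := by rw [← Real.exp_add, ← Real.exp_add]; congr 1; ring
  have hfint : ∀ p, Integrable (fun ω => f p (X ω)) P := fun p => by
    refine ((hexp ‖p‖).mul_const (Real.exp ‖p‖)).mono'
      ((hfm p).comp_aemeasurable hX).aestronglyMeasurable (.of_forall fun ω => ?_)
    rw [← Real.exp_add]
    exact (hbd _).trans (Real.exp_le_exp.2 (harg ‖p‖ p _ le_rfl))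
  have hF : ∀ (K : ℕ) p q, ‖p‖ ≤ K → ‖q‖ ≤ K →
      |∫ ω, f p (X ω) ∂P - ∫ ω, f q (X ω) ∂P| ≤ ‖p - q‖ * ∫ ω, G K (X ω) ∂P := by
    intro K p q hp hq
    rw [← integral_sub (hfint p) (hfint q), ← integral_const_mul]
    refine abs_integral_le_integral_abs.trans (integral_mono ((hfint p).sub (hfint q)).abs
      ((hGint K).const_mul _) fun ω => hl K p q _ hp hq)
  -- Countably many applications of the strong law, over `D` and over the Lipschitz bounds `G K`,
  -- yield one null set outside which all parameter sequences are allowed, including those computed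
  -- from the sample.
  obtain ⟨D, hDc, hD⟩ := TopologicalSpace.exists_countable_dense (E × ℝ)
  have h1 : ∀ᵐ ω ∂P, ∀ K : ℕ, Tendsto (fun n : ℕ => (n : ℝ)⁻¹ • ∑ j : Fin n, G K (Xs j ω)) atTop
      (𝓝 (∫ ω, G K (X ω) ∂P)) :=
    ae_all_iff.2 fun K => ae_tendsto_average hindep hident (hGm K) (hGint K)
  have h2 : ∀ᵐ ω ∂P, ∀ q ∈ D, Tendsto (fun n : ℕ => (n : ℝ)⁻¹ • ∑ j : Fin n, f q (Xs j ω)) atTop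
      (𝓝 (∫ ω, f q (X ω) ∂P)) :=
    (ae_ball_iff hDc).2 fun q _ => ae_tendsto_average hindep hident (hfm q) (hfint q)
  filter_upwards [h1, h2] with ω hω1 hω2 a b a₀ b₀ ha hb
  exact tendsto_average_of_dense (f := f) (F := fun p => ∫ ω, f p (X ω) ∂P) (x := fun j => Xs j ω)
    hD hl hF hω1 hω2 (ha.prodMk_nhds hb)

omit [IsProbabilityMeasure P] in
theorem ae_tendsto_sampleMean (hindep : iIndepFun Xs P) (hident : ∀ j, IdentDistrib (Xs j) X P P)
    (hint : Integrable X P) :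
    ∀ᵐ ω ∂P, Tendsto (fun n : ℕ => sampleMean fun j : Fin n => Xs j ω) atTop
      (𝓝 (∫ ω, X ω ∂P)) :=
  ae_tendsto_average (φ := id) hindep hident measurable_id hint

theorem sampleCov_apply_eq {n : ℕ} (hn : 0 < n) (x : Fin n → EuclideanSpace ℝ (Fin d))
    (k l : Fin d) : sampleCov x k l
      = (n : ℝ)⁻¹ • ∑ j, x j k * x j l - sampleMean x k * sampleMean x l := by
  have hn' : (n : ℝ) ≠ 0 := by positivity
  have hm : ∀ k, sampleMean x k = (n : ℝ)⁻¹ * ∑ j, x j k := fun k => by simp [sampleMean]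
  have hs : ∀ k, ∑ j, x j k = n * sampleMean x k := fun k => by rw [hm]; field_simp
  simp only [sampleCov, Matrix.of_apply, PiLp.sub_apply, smul_eq_mul, sub_mul, mul_sub,
    Finset.sum_sub_distrib, ← Finset.sum_mul, ← Finset.mul_sum, hs, Finset.sum_const,
    Finset.card_univ, Fintype.card_fin, nsmul_eq_mul]
  field_simp
  ring

theorem ae_tendsto_sampleCov (hindep : iIndepFun Xs P) (hident : ∀ j, IdentDistrib (Xs j) X P P)
    (hX2 : MemLp X 2 P) :
    ∀ᵐ ω ∂P, Tendsto (fun n : ℕ => sampleCov fun j : Fin n => Xs j ω) atTop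
      (𝓝 (covMat P X)) := by
  have h1 : ∀ᵐ ω ∂P, ∀ k l : Fin d, Tendsto
      (fun n : ℕ => (n : ℝ)⁻¹ • ∑ j : Fin n, Xs j ω k * Xs j ω l) atTop
      (𝓝 (∫ ω, X ω k * X ω l ∂P)) :=
    ae_all_iff.2 fun k => ae_all_iff.2 fun l =>
      ae_tendsto_average (φ := fun x => x k * x l) hindep hident (by fun_prop)
        ((memLp_coord hX2 k).integrable_mul (memLp_coord hX2 l))
  filter_upwards [h1, ae_tendsto_sampleMean hindep hident (hX2.integrable one_le_two)]
    with ω hω1 hω2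
  have hc : ∀ k : Fin d, Tendsto (fun n : ℕ => sampleMean (fun j : Fin n => Xs j ω) k) atTop
      (𝓝 ((∫ ω, X ω ∂P) k)) := fun k =>
    ((EuclideanSpace.proj k : EuclideanSpace ℝ (Fin d) →L[ℝ] ℝ).continuous.tendsto _).comp hω2
  refine tendsto_pi_nhds.2 fun k => tendsto_pi_nhds.2 fun l => ?_
  have hcov : covMat P X k l
      = ∫ ω, X ω k * X ω l ∂P - (∫ ω, X ω ∂P) k * (∫ ω, X ω ∂P) l := by
    rw [covMat, Matrix.of_apply, covariance_eq_sub (memLp_coord hX2 k) (memLp_coord hX2 l),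
      integral_coord hX2, integral_coord hX2]
    rfl
  rw [hcov]
  refine ((hω1 k l).sub ((hc k).mul (hc l))).congr' ?_
  filter_upwards [eventually_gt_atTop 0] with n hn
  rw [sampleCov_apply_eq hn]

theorem ae_tendsto_invSqrt_sampleCov (hindep : iIndepFun Xs P)
    (hident : ∀ j, IdentDistrib (Xs j) X P P) (hX2 : MemLp X 2 P) (hS : (covMat P X).PosDef) :
    ∀ᵐ ω ∂P, Tendsto (fun n : ℕ => invSqrt (sampleCov fun j : Fin n => Xs j ω)) atTop
      (𝓝 (invSqrt (covMat P X))) := by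
  filter_upwards [ae_tendsto_sampleCov hindep hident hX2] with ω hω
  exact tendsto_invSqrt (fun n => sampleCov_posSemidef _) hS hω

/-- Moving the symmetric matrix onto `t` lets the estimated mean and covariance enter only through a
vector and a scalar, which is the form `⟪a, x⟫ - b` of the uniform strong law. -/
theorem inner_scaledResidual {n : ℕ} (x : Fin n → EuclideanSpace ℝ (Fin d))
    (t : EuclideanSpace ℝ (Fin d)) (j : Fin n) :
    ⟪t, scaledResidual x j⟫ = ⟪invSqrt (sampleCov x) t, x j⟫
      - ⟪invSqrt (sampleCov x) t, sampleMean x⟫ := by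
  rw [scaledResidual, inner_invSqrt_comm, inner_sub_right]

omit [IsProbabilityMeasure P] in
theorem inner_standardized (t : EuclideanSpace ℝ (Fin d)) (ω : Ω) :
    ⟪t, standardized P X ω⟫ = ⟪invSqrt (covMat P X) t, X ω⟫
      - ⟪invSqrt (covMat P X) t, ∫ ω, X ω ∂P⟫ := by
  rw [standardized, inner_invSqrt_comm, inner_sub_right]

omit [IsProbabilityMeasure P] in
theorem aemeasurable_standardized (hX : AEMeasurable X P) :
    AEMeasurable (standardized P X) P := by
  unfold standardized; fun_prop

theorem realCharFun_eq_integral_cos {Z : Ω → EuclideanSpace ℝ (Fin d)} (hZ : AEMeasurable Z P)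
    (t : EuclideanSpace ℝ (Fin d)) : realCharFun P Z t = ∫ ω, Real.cos ⟪t, Z ω⟫ ∂P := by
  have hint : Integrable (fun ω => Complex.exp (⟪Z ω, t⟫ * Complex.I)) P := by
    refine Integrable.of_bound (C := 1) (by fun_prop) (.of_forall fun ω => ?_)
    rw [Complex.norm_exp_ofReal_mul_I]
  have h1 := Complex.reCLM.integral_comp_comm hint
  rw [realCharFun, charFun_apply, integral_map hZ (by fun_prop)]
  simp only [Complex.reCLM_apply] at h1
  rw [← h1]
  congr 1 with ω
  rw [Complex.exp_ofReal_mul_I_re, real_inner_comm]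

/-- Almost surely the empirical transforms converge everywhere to those of the standardization. -/
theorem ae_tendsto_empCos_empMGF (hindep : iIndepFun Xs P)
    (hident : ∀ j, IdentDistrib (Xs j) X P P)
    (hmgf : ∀ t : EuclideanSpace ℝ (Fin d), Integrable (fun ω => Real.exp ⟪t, X ω⟫) P)
    (hS : (covMat P X).PosDef) :
    ∀ᵐ ω ∂P, ∀ t,
      Tendsto (fun n : ℕ => empCos (fun j : Fin n => Xs j ω) t) atTop
        (𝓝 (realCharFun P (standardized P X) t)) ∧
      Tendsto (fun n : ℕ => empMGF (fun j : Fin n => Xs j ω) t) atTop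
        (𝓝 (momentGenFun P (standardized P X) t)) := by
  have hX : AEMeasurable X P := (hident 0).aemeasurable_snd
  have hX2 := memLp_two_of_mgf hX hmgf
  filter_upwards [ae_tendsto_invSqrt_sampleCov hindep hident hX2 hS,
    ae_tendsto_sampleMean hindep hident (hX2.integrable one_le_two),
    ae_forall_tendsto_average hindep hident (integrable_exp_mul_norm hX hmgf) Real.continuous_cos
      (fun B u v hu _ => by
        have h0 : 0 ≤ B := (abs_nonneg u).trans hu
        calc |Real.cos u - Real.cos v| ≤ |u - v| * 1 := by
              rw [mul_one]; exact Real.abs_cos_sub_cos_le u v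
          _ ≤ |u - v| * Real.exp B := by gcongr; exact Real.one_le_exp h0)
      (fun u => (Real.abs_cos_le_one u).trans (Real.one_le_exp (abs_nonneg u))),
    ae_forall_tendsto_average hindep hident (integrable_exp_mul_norm hX hmgf) Real.continuous_exp
      (fun B u v hu hv => abs_exp_sub_exp_le hu hv)
      (fun u => by rw [Real.abs_exp]; exact Real.exp_le_exp.2 (le_abs_self u))]
    with ω hA hm hcos hexp t
  have ha : Tendsto (fun n : ℕ => invSqrt (sampleCov fun j : Fin n => Xs j ω) t) atTop
      (𝓝 (invSqrt (covMat P X) t)) :=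
    ((ContinuousLinearMap.apply ℝ (EuclideanSpace ℝ (Fin d)) t).continuous.tendsto _).comp hA
  have hb := ha.inner (𝕜 := ℝ) hm
  rw [realCharFun_eq_integral_cos (aemeasurable_standardized hX)]
  simp only [momentGenFun, empCos, empMGF, inner_scaledResidual, inner_standardized]
  exact ⟨hcos _ _ _ _ ha hb, hexp _ _ _ _ ha hb⟩

end StrongLaw

/-! ### Fatou's bound and positivity of the limit -/

section Consistency

variable {d : ℕ} {Ω : Type*} [MeasurableSpace Ω] {P : Measure Ω} [IsProbabilityMeasure P]
  {X : Ω → EuclideanSpace ℝ (Fin d)} {Xs : ℕ → Ω → EuclideanSpace ℝ (Fin d)}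

/-- The sets of outcomes lying in `A m` for all `m ≥ n` increase to a set of full measure.
Continuity from below holds for arbitrary sets, so no measurability of `A n` is needed. -/
theorem tendsto_measure_one_of_ae_eventually {A : ℕ → Set Ω}
    (h : ∀ᵐ ω ∂P, ∀ᶠ n in atTop, ω ∈ A n) : Tendsto (fun n => P (A n)) atTop (𝓝 1) := by
  set B : ℕ → Set Ω := fun n => {ω | ∀ m ≥ n, ω ∈ A m} with hB
  have hmono : Monotone B := fun n m hnm ω hω k hk => hω k (hnm.trans hk)
  have h1 := tendsto_measure_iUnion_atTop (μ := P) hmono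
  have h2 : P (⋃ n, B n) = 1 := by
    have : (⋃ n, B n) =ᵐ[P] Set.univ := by
      refine eventuallyEq_univ.2 ?_
      filter_upwards [h] with ω hω
      obtain ⟨N, hN⟩ := eventually_atTop.1 hω
      exact Set.mem_iUnion.2 ⟨N, hN⟩
    rw [measure_congr this, measure_univ]
  rw [h2] at h1
  exact tendsto_of_tendsto_of_tendsto_of_le_of_le h1 tendsto_const_nhds
    (fun n => measure_mono fun ω hω => hω n le_rfl) (fun n => prob_le_one)

theorem lintegral_le_liminf_testStat {γ : ℝ} (hγ : 0 < γ) {x : ℕ → EuclideanSpace ℝ (Fin d)}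
    {R M : EuclideanSpace ℝ (Fin d) → ℝ}
    (h : ∀ t, Tendsto (fun n : ℕ => empCos (fun j : Fin n => x j) t) atTop (𝓝 (R t)) ∧
      Tendsto (fun n : ℕ => empMGF (fun j : Fin n => x j) t) atTop (𝓝 (M t))) :
    ∫⁻ t, ENNReal.ofReal ((R t * M t - 1) ^ 2 * weight γ t)
      ≤ liminf (fun n : ℕ => ENNReal.ofReal (testStat γ (fun j : Fin n => x j) / n)) atTop := by
  set f : ℕ → EuclideanSpace ℝ (Fin d) → ℝ := fun n t =>
    (empCos (fun j : Fin n => x j) t * empMGF (fun j : Fin n => x j) t - 1) ^ 2 * weight γ t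
  have hf : ∀ n, Measurable fun t => ENNReal.ofReal (f n t) := fun n =>
    (Continuous.measurable ((((continuous_empCos _).mul (continuous_empMGF _)).sub
      continuous_const).pow 2 |>.mul (continuous_weight γ))).ennreal_ofReal
  have hlim : ∀ t, ENNReal.ofReal ((R t * M t - 1) ^ 2 * weight γ t)
      = liminf (fun n => ENNReal.ofReal (f n t)) atTop := fun t => by
    refine (Tendsto.liminf_eq ?_).symm
    exact ENNReal.tendsto_ofReal (((((h t).1.mul (h t).2).sub_const 1).pow 2).mul_const _)
  simp only [hlim]
  refine (lintegral_liminf_le hf).trans (le_of_eq ?_)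
  refine liminf_congr ?_
  filter_upwards [eventually_gt_atTop 0] with n hn
  rw [testStat_div γ hn, ofReal_integral_eq_lintegral_ofReal (integrable_sq_mul_weight hγ _)
    (.of_forall fun t => mul_nonneg (sq_nonneg _) (weight_pos γ t).le)]

omit [IsProbabilityMeasure P] in
theorem continuous_momentGenFun {Z : Ω → EuclideanSpace ℝ (Fin d)} (hZ : AEMeasurable Z P)
    (hexp : ∀ K : ℝ, Integrable (fun ω => Real.exp (K * ‖Z ω‖)) P) :
    Continuous (momentGenFun P Z) := by
  refine continuous_iff_continuousAt.2 fun t₀ => ?_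
  refine continuousAt_of_dominated (bound := fun ω => Real.exp ((‖t₀‖ + 1) * ‖Z ω‖))
    (.of_forall fun t => by fun_prop) ?_ (hexp _) (.of_forall fun ω => by fun_prop)
  filter_upwards [Metric.ball_mem_nhds t₀ one_pos] with t ht
  refine .of_forall fun ω => ?_
  rw [Real.norm_of_nonneg (Real.exp_pos _).le, Real.exp_le_exp]
  refine (real_inner_le_norm _ _).trans ?_
  gcongr
  rw [Metric.mem_ball, dist_eq_norm] at ht
  have := norm_sub_norm_le t t₀
  linarith

omit [IsProbabilityMeasure P] in
theorem integrable_exp_mul_norm_standardized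
    (hexp : ∀ K : ℝ, Integrable (fun ω => Real.exp (K * ‖X ω‖)) P) (hX : AEMeasurable X P) (K : ℝ) :
    Integrable (fun ω => Real.exp (K * ‖standardized P X ω‖)) P := by
  set A := invSqrt (covMat P X)
  set m := ∫ ω, X ω ∂P
  have hZ := aemeasurable_standardized (P := P) hX
  refine ((hexp (|K| * ‖A‖)).mul_const (Real.exp (|K| * ‖A‖ * ‖m‖))).mono' (by fun_prop)
    (.of_forall fun ω => ?_)
  rw [Real.norm_of_nonneg (Real.exp_pos _).le, ← Real.exp_add, Real.exp_le_exp]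
  have h1 : ‖standardized P X ω‖ ≤ ‖A‖ * (‖X ω‖ + ‖m‖) :=
    (A.le_opNorm _).trans (by gcongr; exact norm_sub_le _ _)
  calc K * ‖standardized P X ω‖ ≤ |K| * (‖A‖ * (‖X ω‖ + ‖m‖)) := by
        gcongr; exact le_abs_self K
    _ = _ := by ring

/-- If `R_Z M_Z = 1` identically for the standardization `Z` of `X`, then `X` is normal. -/
theorem map_mem_nondegNormal (hX : AEMeasurable X P)
    (hexp : ∀ K : ℝ, Integrable (fun ω => Real.exp (K * ‖X ω‖)) P) (hX2 : MemLp X 2 P)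
    (hS : (covMat P X).PosDef)
    (h : ∀ t, realCharFun P (standardized P X) t * momentGenFun P (standardized P X) t = 1) :
    P.map X ∈ nondegNormal d := by
  set m := ∫ ω, X ω ∂P with hm
  refine ⟨m, covMat P X, hS, ?_⟩
  have : IsProbabilityMeasure (P.map X) := Measure.isProbabilityMeasure_map hX
  refine Measure.ext_of_charFun (funext fun s => ?_)
  set W : Ω → ℝ := fun ω => ⟪s, X ω⟫ - ⟪s, m⟫ with hWdef
  have hW : AEMeasurable W P := by fun_prop
  -- The choice `t = Σ^{1/2} s` turns the hypothesis along the line `τ • t` into the one-dimensional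
  -- identity for `W = ⟪s, X - m⟫`.
  set t := Matrix.toEuclideanCLM (𝕜 := ℝ) (CFC.sqrt (covMat P X)) s
  have hts : invSqrt (covMat P X) t = s := by
    rw [invSqrt, ← mul_apply_eq_comp, ← map_mul, Matrix.nonsing_inv_mul _
      (det_sqrt_ne_zero hS.posSemidef hS.det_pos.ne').isUnit, map_one]
    rfl
  have hinner : ∀ (τ : ℝ) ω, ⟪τ • t, standardized P X ω⟫ = τ * W ω := fun τ ω => by
    rw [inner_standardized, map_smul, hts, real_inner_smul_left, real_inner_smul_left, ← mul_sub]
  have hint : ∀ τ : ℝ, Integrable (fun ω => Real.exp (τ * W ω)) P := fun τ => by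
    refine (integrable_exp_mul_norm_standardized hexp hX ‖τ • t‖).mono' (by fun_prop)
      (.of_forall fun ω => ?_)
    rw [Real.norm_of_nonneg (Real.exp_pos _).le, Real.exp_le_exp, ← hinner]
    exact real_inner_le_norm _ _
  have hcfW : ∀ τ : ℝ, (charFun (P.map W) τ).re = realCharFun P (standardized P X) (τ • t) :=
    fun τ => by
      rw [realCharFun_eq_integral_cos (aemeasurable_standardized hX), charFun_apply_real,
        integral_map hW (by fun_prop)]
      have hi : Integrable (fun ω => Complex.exp (τ * W ω * Complex.I)) P := by
        refine Integrable.of_bound (C := 1) (by fun_prop) (.of_forall fun ω => ?_)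
        rw [← Complex.ofReal_mul, Complex.norm_exp_ofReal_mul_I]
      have h1 := Complex.reCLM.integral_comp_comm hi
      simp only [Complex.reCLM_apply] at h1
      rw [← h1]
      congr 1 with ω
      rw [hinner, ← Complex.ofReal_mul, Complex.exp_ofReal_mul_I_re]
  obtain ⟨v, hv⟩ := map_eq_gaussianReal_of_re_charFun_mul_mgf hW hint fun τ => by
    rw [hcfW, ← h (τ • t)]
    simp only [mgf, momentGenFun, hinner]
  have hvar : (v : ℝ) = s.ofLp ⬝ᵥ (covMat P X).mulVec s.ofLp := by
    rw [dotProduct_covMat_mulVec hX2]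
    have h1 : Var[W; P] = v := by
      rw [← variance_id_gaussianReal (μ := 0) (v := v), ← hv,
        variance_map aemeasurable_id hW]
      rfl
    rw [← h1, hWdef, variance_sub_const (by fun_prop)]
  rw [charFun_multivariateGaussian hS.posSemidef, ← hvar]
  have hX1 : charFun (P.map X) s = Complex.exp (⟪s, m⟫ * Complex.I) * charFun (P.map W) 1 := by
    rw [charFun_apply, charFun_apply_real, integral_map hX (by fun_prop),
      integral_map hW (by fun_prop), ← integral_const_mul]
    congr 1 with ω
    rw [← Complex.exp_add, real_inner_comm]
    congr 1
    simp only [hWdef]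
    push_cast
    ring
  rw [hX1, hv, charFun_gaussianReal, ← Complex.exp_add]
  congr 1
  push_cast
  ring

/-- If the integral vanished, `R_Z M_Z = 1` would hold almost everywhere, hence everywhere by
continuity, and `X` would be normal. -/
theorem lintegral_pos_of_not_normal (hX : AEMeasurable X P)
    (hmgf : ∀ t : EuclideanSpace ℝ (Fin d), Integrable (fun ω => Real.exp ⟪t, X ω⟫) P)
    (hS : (covMat P X).PosDef) (hnot : P.map X ∉ nondegNormal d) (γ : ℝ) :
    0 < ∫⁻ t, ENNReal.ofReal ((realCharFun P (standardized P X) t *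
      momentGenFun P (standardized P X) t - 1) ^ 2 * weight γ t) := by
  have hexp := integrable_exp_mul_norm hX hmgf
  have hZ := aemeasurable_standardized (P := P) hX
  have : IsProbabilityMeasure (P.map (standardized P X)) := Measure.isProbabilityMeasure_map hZ
  have hRc : Continuous (realCharFun P (standardized P X)) :=
    Complex.continuous_re.comp continuous_charFun
  have hMc := continuous_momentGenFun hZ (integrable_exp_mul_norm_standardized hexp hX)
  have hw : Continuous (weight γ : EuclideanSpace ℝ (Fin d) → ℝ) := continuous_weight γ
  rw [pos_iff_ne_zero]
  intro h0
  rw [lintegral_eq_zero_iff (Measurable.ennreal_ofReal (Continuous.measurable (by fun_prop)))] at h0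
  refine hnot (map_mem_nondegNormal hX hexp (memLp_two_of_mgf hX hmgf) hS fun t => ?_)
  have hae : (fun t => realCharFun P (standardized P X) t * momentGenFun P (standardized P X) t)
      =ᵐ[volume] fun _ => 1 := by
    filter_upwards [h0] with t ht
    have h1 : (realCharFun P (standardized P X) t * momentGenFun P (standardized P X) t - 1) ^ 2
        * weight γ t ≤ 0 := ENNReal.ofReal_eq_zero.1 ht
    have h2 := nonpos_of_mul_nonpos_left h1 (weight_pos γ t)
    have h3 := pow_eq_zero_iff two_ne_zero |>.1 (le_antisymm h2 (sq_nonneg _))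
    linarith
  exact congrFun ((hRc.mul hMc).ae_eq_iff_eq volume continuous_const |>.1 hae) t

/-- Any real `ε` strictly between `0` and `Δ` separates: almost surely `T_n / n` eventually lies
above it and `c n / n` below. A finite `ε` exists even if `Δ = ∞`. -/
theorem tendsto_measure_testStat_gt {γ : ℝ} {Δ : ℝ≥0∞} (hΔ : 0 < Δ)
    (h : ∀ᵐ ω ∂P, Δ ≤ liminf (fun n : ℕ => ENNReal.ofReal
      (testStat γ (fun j : Fin n => Xs j ω) / n)) atTop)
    {c : ℕ → ℝ} (hc : Tendsto (fun n : ℕ => c n / n) atTop (𝓝 0)) :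
    Tendsto (fun n : ℕ => P {ω | c n < testStat γ (fun j : Fin n => Xs j ω)}) atTop (𝓝 1) := by
  obtain ⟨ε, hε0, hε⟩ := ENNReal.lt_iff_exists_real_btwn.1 hΔ
  have hεpos : 0 < ε := ENNReal.ofReal_pos.1 hε.1
  refine tendsto_measure_one_of_ae_eventually ?_
  filter_upwards [h] with ω hω
  filter_upwards [eventually_lt_of_lt_liminf (hε.2.trans_le hω), hc.eventually_lt_const hεpos,
    eventually_gt_atTop 0] with n h1 h2 hn
  have h3 := (ENNReal.ofReal_lt_ofReal_iff_of_nonneg hε0).1 h1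
  have h4 := h2.trans h3
  rwa [div_lt_div_iff_of_pos_right (by exact_mod_cast hn)] at h4

end Consistency

/-! ### The null distribution and the critical values -/

section Gaussian

variable {d : ℕ}

theorem integrable_exp_mul_sq_gaussianReal {c : ℝ} (hc : c < 1 / 2) :
    Integrable (fun x : ℝ => Real.exp (c * x ^ 2)) (gaussianReal 0 1) := by
  rw [gaussianReal_of_var_ne_zero _ one_ne_zero,
    integrable_withDensity_iff_integrable_smul₀' (measurable_gaussianPDF 0 1).aemeasurable
      (.of_forall fun x => gaussianPDF_lt_top)]
  refine ((integrable_exp_neg_mul_sq (b := 1 / 2 - c) (by linarith)).const_mul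
    (√(2 * Real.pi))⁻¹).congr (.of_forall fun x => ?_)
  simp only [toReal_gaussianPDF, gaussianPDFReal, smul_eq_mul, NNReal.coe_one, mul_one, sub_zero]
  rw [mul_assoc, ← Real.exp_add]
  congr 2
  ring

theorem integrable_exp_mul_norm_sq_stdGaussian {c : ℝ} (hc : c < 1 / 2) :
    Integrable (fun x : EuclideanSpace ℝ (Fin d) => Real.exp (c * ‖x‖ ^ 2))
      (stdGaussian (EuclideanSpace ℝ (Fin d))) := by
  rw [← map_pi_eq_stdGaussian, integrable_map_measure (by fun_prop) (by fun_prop)]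
  have := Integrable.fintype_prod (ι := Fin d) (μ := fun _ => gaussianReal 0 1)
    (f := fun _ x => Real.exp (c * x ^ 2)) fun _ => integrable_exp_mul_sq_gaussianReal hc
  refine this.congr (.of_forall fun x => ?_)
  simp only [Function.comp, EuclideanSpace.real_norm_sq_eq, Finset.mul_sum, Real.exp_sum]

theorem inner_le_young {ρ : ℝ} (hρ : 0 < ρ) (a x : EuclideanSpace ℝ (Fin d)) :
    ⟪a, x⟫ ≤ ρ / 2 * ‖a‖ ^ 2 + 1 / (2 * ρ) * ‖x‖ ^ 2 := by
  refine (real_inner_le_norm a x).trans ?_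
  have h : 0 ≤ (ρ * ‖a‖ - ‖x‖) ^ 2 / (2 * ρ) := by positivity
  have e : (ρ * ‖a‖ - ‖x‖) ^ 2 / (2 * ρ)
      = ρ / 2 * ‖a‖ ^ 2 + 1 / (2 * ρ) * ‖x‖ ^ 2 - ‖a‖ * ‖x‖ := by
    field_simp; ring
  linarith

theorem integrable_exp_inner_stdGaussian (t : EuclideanSpace ℝ (Fin d)) :
    Integrable (fun x => Real.exp ⟪t, x⟫) (stdGaussian (EuclideanSpace ℝ (Fin d))) := by
  refine ((integrable_exp_mul_norm_sq_stdGaussian (d := d) (c := 1 / (2 * 2)) (by norm_num)).const_mul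
    (Real.exp (2 / 2 * ‖t‖ ^ 2))).mono' (by fun_prop) (.of_forall fun x => ?_)
  rw [Real.norm_of_nonneg (Real.exp_pos _).le, ← Real.exp_add, Real.exp_le_exp]
  exact inner_le_young two_pos t x

theorem integral_exp_inner_stdGaussian (t : EuclideanSpace ℝ (Fin d)) :
    ∫ x, Real.exp ⟪t, x⟫ ∂(stdGaussian (EuclideanSpace ℝ (Fin d))) = Real.exp (‖t‖ ^ 2 / 2) := by
  have h1 := IsGaussian.map_eq_gaussianReal (μ := stdGaussian (EuclideanSpace ℝ (Fin d)))
    (innerSL ℝ t)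
  rw [integral_strongDual_stdGaussian, variance_dual_stdGaussian, innerSL_apply_norm] at h1
  have h2 := mgf_gaussianReal h1 1
  rw [Real.coe_toNNReal _ (by positivity)] at h2
  simpa [mgf] using h2

theorem invSqrt_one : invSqrt (1 : Matrix (Fin d) (Fin d) ℝ) = 1 := by
  rw [invSqrt, CFC.sqrt_one, inv_one, map_one]

variable {Ω : Type*} [MeasurableSpace Ω] {P : Measure Ω} [IsProbabilityMeasure P]
  {X : Ω → EuclideanSpace ℝ (Fin d)} {Xs : ℕ → Ω → EuclideanSpace ℝ (Fin d)}

omit [IsProbabilityMeasure P] in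
theorem covMat_eq_one_of_map_eq (hX : AEMeasurable X P)
    (hlaw : P.map X = stdGaussian (EuclideanSpace ℝ (Fin d))) : covMat P X = 1 := by
  ext k l
  have h := covariance_eval_multivariateGaussian (μ := (0 : EuclideanSpace ℝ (Fin d)))
    Matrix.PosSemidef.one k l
  rw [multivariateGaussian_zero_one, ← hlaw, covariance_map (by fun_prop) (by fun_prop) hX] at h
  exact h

omit [IsProbabilityMeasure P] in
theorem standardized_eq_self_of_map_eq (hX : AEMeasurable X P)
    (hlaw : P.map X = stdGaussian (EuclideanSpace ℝ (Fin d))) : standardized P X = X := by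
  have hm : ∫ ω, X ω ∂P = 0 := by
    rw [← integral_id_stdGaussian (E := EuclideanSpace ℝ (Fin d)), ← hlaw,
      integral_map hX (by fun_prop)]
  ext1 ω
  rw [standardized, covMat_eq_one_of_map_eq hX hlaw, invSqrt_one, hm, sub_zero, one_apply_eq_self]

omit [IsProbabilityMeasure P] in
theorem realCharFun_mul_momentGenFun_of_map_eq (hX : AEMeasurable X P)
    (hlaw : P.map X = stdGaussian (EuclideanSpace ℝ (Fin d))) (t : EuclideanSpace ℝ (Fin d)) :
    realCharFun P X t * momentGenFun P X t = 1 := by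
  have h1 : momentGenFun P X t = Real.exp (‖t‖ ^ 2 / 2) := by
    rw [← integral_exp_inner_stdGaussian, ← hlaw, integral_map hX (by fun_prop), momentGenFun]
  have h2 : realCharFun P X t = Real.exp (-(‖t‖ ^ 2 / 2)) := by
    rw [realCharFun, hlaw, charFun_stdGaussian,
      show (-(‖t‖ : ℂ) ^ 2 / 2) = ((-(‖t‖ ^ 2 / 2) : ℝ) : ℂ) by push_cast; ring,
      Complex.exp_ofReal_re]
  rw [h1, h2, ← Real.exp_add, neg_add_cancel, Real.exp_zero]

/-- Domination of the empirical moment generating function by a Gaussian factor. -/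
theorem empMGF_le_of_norm_le {n : ℕ} {ρ L : ℝ} (hρ : 1 ≤ ρ) (x : Fin n → EuclideanSpace ℝ (Fin d))
    (hA : ‖invSqrt (sampleCov x)‖ ≤ ρ) (hm : ‖sampleMean x‖ ≤ 1)
    (hL : (n : ℝ)⁻¹ • ∑ j, Real.exp (1 / (2 * ρ) * ‖x j‖ ^ 2) ≤ L)
    (t : EuclideanSpace ℝ (Fin d)) :
    empMGF x t ≤ L * Real.exp (ρ * ‖t‖ + ρ ^ 3 / 2 * ‖t‖ ^ 2) := by
  have hρ0 : 0 < ρ := by linarith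
  set a := invSqrt (sampleCov x) t with ha_def
  have ha : ‖a‖ ≤ ρ * ‖t‖ := (ContinuousLinearMap.le_opNorm _ t).trans (by gcongr)
  have hterm : ∀ j, Real.exp ⟪t, scaledResidual x j⟫
      -- Young's inequality with weight `ρ` separates `x j` from `t`: for `ρ > 1` the coefficient `1
      -- / (2ρ)` is below the Gaussian threshold `1/2`, while `‖a‖ ≤ ρ ‖t‖` leaves `ρ^3 / 2` in
      -- front of `‖t‖^2`.
      ≤ Real.exp (1 / (2 * ρ) * ‖x j‖ ^ 2) * Real.exp (ρ * ‖t‖ + ρ ^ 3 / 2 * ‖t‖ ^ 2) := fun j => by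
    rw [inner_scaledResidual, ← ha_def, ← Real.exp_add, Real.exp_le_exp]
    have h1 := inner_le_young hρ0 a (x j)
    have h2 : -⟪a, sampleMean x⟫ ≤ ρ * ‖t‖ := by
      have h3 := (abs_le.1 (abs_real_inner_le_norm a (sampleMean x))).1
      have h4 : ‖a‖ * ‖sampleMean x‖ ≤ ρ * ‖t‖ * 1 := by gcongr
      linarith
    have h5 : ρ / 2 * ‖a‖ ^ 2 ≤ ρ ^ 3 / 2 * ‖t‖ ^ 2 := by
      calc ρ / 2 * ‖a‖ ^ 2 ≤ ρ / 2 * (ρ * ‖t‖) ^ 2 := by gcongr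
        _ = _ := by ring
    linarith
  calc empMGF x t ≤ (n : ℝ)⁻¹ * ∑ j, Real.exp (1 / (2 * ρ) * ‖x j‖ ^ 2)
        * Real.exp (ρ * ‖t‖ + ρ ^ 3 / 2 * ‖t‖ ^ 2) := by
        unfold empMGF
        gcongr with j
        exact hterm j
    _ = ((n : ℝ)⁻¹ • ∑ j, Real.exp (1 / (2 * ρ) * ‖x j‖ ^ 2))
        * Real.exp (ρ * ‖t‖ + ρ ^ 3 / 2 * ‖t‖ ^ 2) := by
        rw [← Finset.sum_mul, smul_eq_mul, mul_assoc]
    _ ≤ _ := by gcongr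

/-- For standard normal samples and `γ > 1`, `T_{n,γ} / n → 0` almost surely. -/
theorem ae_tendsto_testStat_div_zero (hindep : iIndepFun Xs P)
    (hident : ∀ j, IdentDistrib (Xs j) X P P)
    (hlaw : P.map X = stdGaussian (EuclideanSpace ℝ (Fin d))) {γ : ℝ} (hγ : 1 < γ) :
    ∀ᵐ ω ∂P, Tendsto (fun n : ℕ => testStat γ (fun j : Fin n => Xs j ω) / n) atTop (𝓝 0) := by
  have hX : AEMeasurable X P := (hident 0).aemeasurable_snd
  have hcov := covMat_eq_one_of_map_eq hX hlaw
  have hstd := standardized_eq_self_of_map_eq hX hlaw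
  have hmean : ∫ ω, X ω ∂P = 0 := by
    rw [← integral_id_stdGaussian (E := EuclideanSpace ℝ (Fin d)), ← hlaw,
      integral_map hX (by fun_prop)]
  have hmgf : ∀ t : EuclideanSpace ℝ (Fin d), Integrable (fun ω => Real.exp ⟪t, X ω⟫) P :=
    fun t => (hlaw ▸ integrable_exp_inner_stdGaussian t :
      Integrable (fun x => Real.exp ⟪t, x⟫) (P.map X)).comp_aemeasurable hX
  have hX2 := memLp_two_of_mgf hX hmgf
  have hS : (covMat P X).PosDef := by rw [hcov]; exact Matrix.PosDef.one
  -- The squared bound on the empirical transform grows like `exp (ρ^3 ‖t‖^2)` up to a linear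
  -- exponent, so the weight dominates it when `ρ^3 < γ`. Together with `ρ > 1` this is where `γ >
  -- 1` is needed.
  obtain ⟨ρ, hρ1, hργ⟩ : ∃ ρ : ℝ, 1 < ρ ∧ ρ ^ 3 < γ := by
    have h1 : 1 < √γ := Real.lt_sqrt_of_sq_lt (by linarith)
    have h2 : 1 < √√γ := Real.lt_sqrt_of_sq_lt (by linarith)
    refine ⟨√√γ, h2, ?_⟩
    calc √√γ ^ 3 < √√γ ^ 4 := pow_lt_pow_right₀ h2 (by norm_num)
      _ = (√√γ ^ 2) ^ 2 := by ring
      _ = γ := by rw [Real.sq_sqrt (by positivity), Real.sq_sqrt (by linarith)]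
  have hρ0 : 0 < ρ := by linarith
  have hφint : Integrable (fun ω => Real.exp (1 / (2 * ρ) * ‖X ω‖ ^ 2)) P :=
    (hlaw ▸ integrable_exp_mul_norm_sq_stdGaussian (by
      rw [div_lt_div_iff₀ (by positivity) (by norm_num)]; linarith) :
      Integrable (fun x => Real.exp (1 / (2 * ρ) * ‖x‖ ^ 2)) (P.map X)).comp_aemeasurable hX
  filter_upwards [ae_tendsto_empCos_empMGF hindep hident hmgf hS,
    ae_tendsto_invSqrt_sampleCov hindep hident hX2 hS,
    ae_tendsto_sampleMean hindep hident (hX2.integrable one_le_two),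
    ae_tendsto_average (φ := fun x => Real.exp (1 / (2 * ρ) * ‖x‖ ^ 2)) hindep hident
      (by fun_prop) hφint] with ω hRM hA hm hG
  rw [hcov, invSqrt_one] at hA
  rw [hmean] at hm
  set L := |∫ ω, Real.exp (1 / (2 * ρ) * ‖X ω‖ ^ 2) ∂P| + 1
  have hL1 : 1 ≤ L := le_add_of_nonneg_left (abs_nonneg _)
  have eA : ∀ᶠ n : ℕ in atTop, ‖invSqrt (sampleCov fun j : Fin n => Xs j ω)‖ ≤ ρ := by
    have h1 : ‖(1 : EuclideanSpace ℝ (Fin d) →L[ℝ] EuclideanSpace ℝ (Fin d))‖ < ρ :=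
      lt_of_le_of_lt ContinuousLinearMap.norm_id_le hρ1
    exact (hA.norm.eventually_lt_const h1).mono fun _ h => h.le
  have em : ∀ᶠ n : ℕ in atTop, ‖sampleMean fun j : Fin n => Xs j ω‖ ≤ 1 := by
    have h1 : ‖(0 : EuclideanSpace ℝ (Fin d))‖ < 1 := by simp
    exact (hm.norm.eventually_lt_const h1).mono fun _ h => h.le
  have eG : ∀ᶠ n : ℕ in atTop,
      (n : ℝ)⁻¹ • ∑ j : Fin n, Real.exp (1 / (2 * ρ) * ‖Xs j ω‖ ^ 2) ≤ L :=
    (hG.eventually_lt_const (lt_of_le_of_lt (le_abs_self _) (lt_add_one _))).mono fun _ h => h.le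
  have hlim : Tendsto (fun n : ℕ => ∫ t, (empCos (fun j : Fin n => Xs j ω) t
      * empMGF (fun j : Fin n => Xs j ω) t - 1) ^ 2 * weight γ t) atTop
      (𝓝 (∫ _ : EuclideanSpace ℝ (Fin d), (0 : ℝ))) := by
    refine tendsto_integral_filter_of_dominated_convergence
      (fun t => 4 * L ^ 2 * Real.exp (2 * ρ * ‖t‖ - (γ - ρ ^ 3) * ‖t‖ ^ 2))
      (.of_forall fun n => (integrable_sq_mul_weight (by linarith) _).aestronglyMeasurable) ?_
      ((integrable_exp_mul_norm_sub (by linarith) _).const_mul _) (.of_forall fun t => ?_)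
    · filter_upwards [eA, em, eG] with n h1 h2 h3
      refine .of_forall fun t => ?_
      rw [Real.norm_of_nonneg (mul_nonneg (sq_nonneg _) (weight_pos γ t).le)]
      have hB := empMGF_le_of_norm_le hρ1.le (fun j : Fin n => Xs j ω) h1 h2 h3 t
      have hB1 : 1 ≤ L * Real.exp (ρ * ‖t‖ + ρ ^ 3 / 2 * ‖t‖ ^ 2) :=
        one_le_mul_of_one_le_of_one_le hL1 (Real.one_le_exp (by positivity))
      refine (mul_le_mul_of_nonneg_right (sq_mul_sub_one_le (abs_empCos_le_one _ t)
        (empMGF_nonneg _ t) hB hB1) (weight_pos γ t).le).trans (le_of_eq ?_)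
      rw [weight, mul_pow, ← Real.exp_nat_mul, ← mul_assoc, mul_assoc, ← Real.exp_add]
      congr 2
      push_cast
      ring
    · have h1 := ((((hRM t).1.mul (hRM t).2).sub_const 1).pow 2).mul_const (weight γ t)
      rw [hstd, realCharFun_mul_momentGenFun_of_map_eq hX hlaw] at h1
      simpa using h1
  rw [integral_zero] at hlim
  refine hlim.congr' ?_
  filter_upwards [eventually_gt_atTop 0] with n hn
  rw [testStat_div γ hn]

/-- The almost sure limit needs all sample sizes on one space, here the infinite product; the law of
its first `n` coordinates is the finite product. -/
theorem tendsto_pi_stdGaussian_testStat_gt {γ : ℝ} (hγ : 1 < γ) {ε : ℝ} (hε : 0 < ε) :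
    Tendsto (fun n : ℕ => Measure.pi (fun _ : Fin n => stdGaussian (EuclideanSpace ℝ (Fin d)))
      {x | ε * n < testStat γ x}) atTop (𝓝 0) := by
  set Q := stdGaussian (EuclideanSpace ℝ (Fin d)) with hQ
  set P' : Measure (ℕ → EuclideanSpace ℝ (Fin d)) := Measure.infinitePi fun _ => Q
  let Ys : ℕ → (ℕ → EuclideanSpace ℝ (Fin d)) → EuclideanSpace ℝ (Fin d) := fun j ω => ω j
  have hind : iIndepFun Ys P' := iIndepFun_infinitePi (X := fun _ x => x) fun _ => measurable_id
  have hlaw : ∀ j, P'.map (Ys j) = Q := fun j => Measure.infinitePi_map_eval (fun _ => Q) j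
  have hm : ∀ j, Measurable (Ys j) := fun j => measurable_pi_apply j
  have hid : ∀ j, IdentDistrib (Ys j) (Ys 0) P' P' := fun j =>
    ⟨(hm j).aemeasurable, (hm 0).aemeasurable, by rw [hlaw, hlaw]⟩
  have hA := tendsto_measure_one_of_ae_eventually (P := P')
    (A := fun n => {ω | testStat γ (fun j : Fin n => Ys j ω) ≤ ε * n}) (by
      filter_upwards [ae_tendsto_testStat_div_zero hind hid (hlaw 0) hγ] with ω hω
      filter_upwards [hω.eventually_lt_const hε, eventually_gt_atTop 0] with n h1 hn
      rw [div_lt_iff₀ (by exact_mod_cast hn)] at h1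
      exact h1.le)
  have hmeas : ∀ n : ℕ, Measurable fun ω (j : Fin n) => Ys j ω :=
    fun n => measurable_pi_lambda _ fun j => hm j
  have h1 := ENNReal.Tendsto.sub (tendsto_const_nhds (x := (1 : ℝ≥0∞)) (f := atTop)) hA
    (Or.inl ENNReal.one_ne_top)
  rw [tsub_self] at h1
  refine h1.congr fun n => ?_
  have hmap : P'.map (fun ω (j : Fin n) => Ys j ω) = Measure.pi fun _ : Fin n => Q := by
    have := (iIndepFun_iff_map_fun_eq_pi_map (f := fun (j : Fin n) => Ys j)
      fun j => (hm j).aemeasurable).1 (hind.precomp Fin.val_injective)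
    simpa only [hlaw] using this
  rw [← hmap, Measure.map_apply (hmeas n)
    (measurableSet_lt measurable_const (measurable_testStat γ))]
  have hms : MeasurableSet {ω | testStat γ (fun j : Fin n => Ys j ω) ≤ ε * n} :=
    measurableSet_le ((measurable_testStat γ).comp (hmeas n)) measurable_const
  rw [← prob_compl_eq_one_sub hms]
  congr 1
  ext ω
  simp

/-- The null distribution of the test statistic does not depend on the normal law. -/
theorem pi_nondegNormal_testStat_gt {Q : Measure (EuclideanSpace ℝ (Fin d))}
    (hQ : Q ∈ nondegNormal d) (γ c : ℝ) (n : ℕ) :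
    Measure.pi (fun _ : Fin n => Q) {x | c < testStat γ x}
      = Measure.pi (fun _ : Fin n => stdGaussian (EuclideanSpace ℝ (Fin d)))
        {x | c < testStat γ x} := by
  obtain ⟨m, S, hS, rfl⟩ := hQ
  set A := CFC.sqrt S
  have hA : A.det ≠ 0 := det_sqrt_ne_zero hS.posSemidef hS.det_pos.ne'
  have hf : Measurable fun x : EuclideanSpace ℝ (Fin d) =>
      m + Matrix.toEuclideanCLM (𝕜 := ℝ) A x := Continuous.measurable (by fun_prop)
  have : IsProbabilityMeasure ((stdGaussian (EuclideanSpace ℝ (Fin d))).map fun x =>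
      m + Matrix.toEuclideanCLM (𝕜 := ℝ) A x) :=
    Measure.isProbabilityMeasure_map hf.aemeasurable
  have hpi := Measure.pi_map_pi (ι := Fin n)
    (μ := fun _ => stdGaussian (EuclideanSpace ℝ (Fin d)))
    (f := fun _ x => m + Matrix.toEuclideanCLM (𝕜 := ℝ) A x) fun _ => hf.aemeasurable
  simp only [multivariateGaussian]
  have hfpi : Measurable fun (x : Fin n → EuclideanSpace ℝ (Fin d)) (j : Fin n) =>
      m + Matrix.toEuclideanCLM (𝕜 := ℝ) A (x j) :=
    measurable_pi_lambda _ fun j => hf.comp (measurable_pi_apply j)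
  rw [← hpi, Measure.map_apply hfpi (measurableSet_lt measurable_const (measurable_testStat γ))]
  simp only [Set.preimage_ofPred_eq, testStat_affine γ m hA]

/-- Since `T_n ≥ 0` and `α < 1`, no negative `c` is admissible, so the infimum is over a set bounded
below by `0`. Eventually `(ε / 2) n` is admissible, first for the standard normal law and then for
all by invariance. -/
theorem tendsto_criticalValue_div {γ : ℝ} (hγ : 1 < γ) {α : ℝ} (hα0 : 0 < α) (hα1 : α < 1) :
    Tendsto (fun n : ℕ => criticalValue d γ α n / n) atTop (𝓝 0) := by
  have hlow : ∀ (n : ℕ), ∀ c ∈ {c : ℝ | ∀ Q ∈ nondegNormal d,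
      Measure.pi (fun _ : Fin n => Q) {x | c < testStat γ x} ≤ ENNReal.ofReal α}, 0 ≤ c := by
    intro n c hc
    by_contra hneg
    have h1 := hc (multivariateGaussian 0 1) ⟨0, 1, Matrix.PosDef.one, rfl⟩
    have h2 : {x : Fin n → EuclideanSpace ℝ (Fin d) | c < testStat γ x} = Set.univ :=
      Set.eq_univ_of_forall fun x => (not_le.1 hneg).trans_le (testStat_nonneg γ x)
    rw [h2, measure_univ] at h1
    exact absurd h1 (not_le.2 (by
      rw [← ENNReal.ofReal_one]; exact (ENNReal.ofReal_lt_ofReal_iff one_pos).2 hα1))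
  have hnn : ∀ n : ℕ, 0 ≤ criticalValue d γ α n / n := fun n =>
    div_nonneg (Real.sInf_nonneg (hlow n)) (Nat.cast_nonneg n)
  rw [Metric.tendsto_atTop']
  intro ε hε
  have hev := (tendsto_pi_stdGaussian_testStat_gt (d := d) hγ (half_pos hε)).eventually_lt_const
    (ENNReal.ofReal_pos.2 hα0)
  obtain ⟨N, hN⟩ := eventually_atTop.1 (hev.and (eventually_gt_atTop 0))
  refine ⟨N, fun n hn => ?_⟩
  obtain ⟨h1, h2⟩ := hN n hn.le
  have hle : criticalValue d γ α n ≤ ε / 2 * n :=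
    csInf_le ⟨0, fun c hc => hlow n c hc⟩ fun Q hQ => by
      rw [pi_nondegNormal_testStat_gt hQ]; exact h1.le
  rw [dist_zero_right, Real.norm_of_nonneg (hnn n), div_lt_iff₀ (by exact_mod_cast h2)]
  have : (0 : ℝ) < n := by exact_mod_cast h2
  nlinarith

end Gaussian

end NormalityTest

/-! ### The theorem -/

theorem mainTheorem5 {d : ℕ} {Ω : Type*} [MeasurableSpace Ω]
    (P : Measure Ω) [IsProbabilityMeasure P]
    (X : Ω → EuclideanSpace ℝ (Fin d)) (Xs : ℕ → Ω → EuclideanSpace ℝ (Fin d))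
    (hindep : iIndepFun Xs P) (hident : ∀ j, IdentDistrib (Xs j) X P P)
    (hac : P.map X ≪ volume)
    (hmgf : ∀ t : EuclideanSpace ℝ (Fin d), Integrable (fun ω => Real.exp ⟪t, X ω⟫) P)
    (γ : ℝ) (hγ : 0 < γ) :
    (∀ᵐ ω ∂P,
      ∫⁻ t : EuclideanSpace ℝ (Fin d), ENNReal.ofReal
          ((NormalityTest.realCharFun P (NormalityTest.standardized P X) t *
            NormalityTest.momentGenFun P (NormalityTest.standardized P X) t - 1) ^ 2 *
            NormalityTest.weight γ t)
        ≤ liminf (fun n : ℕ => ENNReal.ofReal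
            (NormalityTest.testStat γ (fun j : Fin n => Xs j ω) / n)) atTop) ∧
    (P.map X ∉ NormalityTest.nondegNormal d →
      (∀ c : ℕ → ℝ, Tendsto (fun n : ℕ => c n / n) atTop (𝓝 0) →
        Tendsto (fun n : ℕ => P {ω | c n < NormalityTest.testStat γ (fun j : Fin n => Xs j ω)})
          atTop (𝓝 1)) ∧
      (1 < γ → ∀ α : ℝ, 0 < α → α < 1 →
        Tendsto (fun n : ℕ => P {ω | NormalityTest.criticalValue d γ α n <
            NormalityTest.testStat γ (fun j : Fin n => Xs j ω)})
          atTop (𝓝 1))) := by 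
  have hX : AEMeasurable X P := (hident 0).aemeasurable_snd
  have hS := NormalityTest.covMat_posDef hX (NormalityTest.memLp_two_of_mgf hX hmgf) hac
  have ha := (NormalityTest.ae_tendsto_empCos_empMGF hindep hident hmgf hS).mono fun ω hω =>
    NormalityTest.lintegral_le_liminf_testStat (x := fun j => Xs j ω) hγ hω
  refine ⟨ha, fun hnot => ?_⟩
  have hΔ := NormalityTest.lintegral_pos_of_not_normal hX hmgf hS hnot γ
  exact ⟨fun c hc => NormalityTest.tendsto_measure_testStat_gt hΔ ha hc,
    fun hγ1 α hα0 hα1 => NormalityTest.tendsto_measure_testStat_gt hΔ ha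
      (NormalityTest.tendsto_criticalValue_div hγ1 hα0 hα1)⟩
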